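/- Let $A$ and $B$ be finitely generated free groups, let $C$ be a finitely generated group, let $\varphi:C\to A$ and $\psi:C\to B$ be injective homomorphisms, and let $G=A*_C B$ be the corresponding free product with amalgamation, with $C$ regarded as a subgroup of $G$. For a subgroup $H$ of a group $G$ and $g\in G$ write $H^g=gHg^{-1}$, and put $$N^*_G(H)=\{g\in G\mid H\cap H^g\neq 1\},\qquad Z_g(H)=\{h\in H\mid ghg^{-1}\in H\},\qquad Z_G(H)=\bigcup_{g\in N^*_G(H)\smallsetminus H}Z_g(H).$$ An element of $G=A*_C B$ is called \emph{singular} if it lies in $(N^*_G(C)\smallsetminus C)\cup Z_G(C)$, and \emph{regular} otherwise. Let $x_1,\dots,x_m$ be any finite generating tuple of $A$ and $y_1,\dots,y_n$ any finite generating tuple of $B$. Then the set of regular elements of $G$ is recursive: the set of all words in the letters $x_1^{\pm1},\dots,x_m^{\pm1},y_1^{\pm1},\dots,y_n^{\pm1}$ that represent a regular element of $G$ is a recursive set of words. -/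

import Mathlib

universe u v

/-- The two factors `A` and `B`, as a family indexed by `Bool`. -/
def AmalgamFactor (A B : Type u) : Bool → Type u
  | false => A
  | true => B

instance AmalgamFactor.instGroup (A B : Type u) [Group A] [Group B] :
    ∀ b : Bool, Group (AmalgamFactor A B b)
  | false => inferInstanceAs (Group A)
  | true => inferInstanceAs (Group B)

/-- The two maps `φ : C → A` and `ψ : C → B`, as a family indexed by `Bool`. -/
def amalgamLegs {A B : Type u} {C : Type v} [Group A] [Group B] [Group C]
    (φ : C →* A) (ψ : C →* B) : ∀ b : Bool, C →* AmalgamFactor A B b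
  | false => φ
  | true => ψ

/-- The amalgamated product `A *_C B`: the pushout of groups of `φ : C → A` and `ψ : C → B`. -/
abbrev AmalgamatedProduct {A B : Type u} {C : Type v} [Group A] [Group B] [Group C]
    (φ : C →* A) (ψ : C →* B) : Type (max u v) :=
  Monoid.PushoutI (amalgamLegs φ ψ)

namespace AmalgamatedProduct

variable {A B : Type u} {C : Type v} [Group A] [Group B] [Group C] (φ : C →* A) (ψ : C →* B)

/-- The canonical map of the factor `A` into `A *_C B`. -/
def inl : A →* AmalgamatedProduct φ ψ :=
  Monoid.PushoutI.of (φ := amalgamLegs φ ψ) false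

/-- The canonical map of the factor `B` into `A *_C B`. -/
def inr : B →* AmalgamatedProduct φ ψ :=
  Monoid.PushoutI.of (φ := amalgamLegs φ ψ) true

/-- The image of the amalgamated subgroup `C` in `A *_C B`. -/
def baseSubgroup : Subgroup (AmalgamatedProduct φ ψ) :=
  (Monoid.PushoutI.base (amalgamLegs φ ψ)).range

/-- The element of `A *_C B` represented by a (not necessarily reduced) group word in the letters
`x₁, …, xₘ` (standing for the elements `x i` of `A`) and `y₁, …, yₙ` (standing for the elements
`y j` of `B`). The letter `(s, true)` stands for `s`, the letter `(s, false)` for its inverse. -/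
def evalWord {m n : ℕ} (x : Fin m → A) (y : Fin n → B)
    (w : List ((Fin m ⊕ Fin n) × Bool)) : AmalgamatedProduct φ ψ :=
  FreeGroup.lift (Sum.elim (fun i => inl φ ψ (x i)) (fun j => inr φ ψ (y j))) (FreeGroup.mk w)

end AmalgamatedProduct

/-- The generalized normalizer `N*_G(H)`: all `g` with `H ∩ H ^ g ≠ 1`, where
`H ^ g = g H g⁻¹`. -/
def generalizedNormalizer {G : Type*} [Group G] (H : Subgroup G) : Set G :=
  {g | H ⊓ H.map (MulAut.conj g).toMonoidHom ≠ ⊥}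

/-- `Z_g(H)`: all `h ∈ H` with `h ^ g = g h g⁻¹ ∈ H`. -/
def conjStaySet {G : Type*} [Group G] (H : Subgroup G) (g : G) : Set G :=
  {h | h ∈ H ∧ g * h * g⁻¹ ∈ H}

/-- `Z_G(H)`: the union of the `Z_g(H)` over `g ∈ N*_G(H) \ H`. -/
def conjStayUnion {G : Type*} [Group G] (H : Subgroup G) : Set G :=
  ⋃ g ∈ generalizedNormalizer H \ (H : Set G), conjStaySet H g

/-- The black hole of `G` relative to `H`, i.e. the set of singular elements. -/
def blackHole {G : Type*} [Group G] (H : Subgroup G) : Set G :=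
  (generalizedNormalizer H \ (H : Set G)) ∪ conjStayUnion H

/-- The regular elements of `G` relative to `H`: those outside the black hole. -/
def regularElements {G : Type*} [Group G] (H : Subgroup G) : Set G :=
  (blackHole H)ᶜ

/-! Every `g` in `G` can be written as `p₁ ⋯ pₙ c` with `c ∈ C` and syllables taken alternately from
`A ∖ C` and `B ∖ C`. This form is computable because membership in the image of `C` is decidable in
each free factor, with preimages.

If `n ≥ 1`, then `g ∉ C`, and `g` is singular exactly when some nontrivial element of `C` is carried
into `C` by conjugation with `g⁻¹`. By the normal form theorem such an element must stay in `C`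
after each syllable (`IsReducedList.conj_mem_range`). The elements of `C` with this property form a
subgroup, obtained by iterating `D ↦ C ∩ pDp⁻¹` over the syllables. Each step intersects finitely
generated subgroups of a free group, and an effective form of Howson's theorem bounds the length of
generators. A nontrivial subgroup has a nontrivial generator, so a finite search decides the
question.

If `n = 0` and `c ≠ 1`, then `g` is singular exactly when a single factor contains some `a ∉ C` with
`aca⁻¹ ∈ C`. The coset `Ca` has a representative of length bounded linearly in that of `c`
(`Quasiconvex.exists_norm_le_of_conj_mem`), so again a finite search suffices. For `g = 1` the
answer is one fixed truth value.

The facts about free groups rest on quasiconvexity of finitely generated subgroups: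
`Quasiconvex.of_closure`, `Quasiconvex.closure_eq`, `Quasiconvex.inf` and the finite automaton of
`exists_transducer`. `FactorAlgorithm` collects what the amalgam argument needs from each factor.
All searches have primitive recursive bounds, so the resulting predicate is even primitive
recursive. -/

theorem List.IsPrefix.of_append {α : Type*} {p a b : List α} (h : p <+: a ++ b) :
    p <+: a ∨ ∃ q, p = a ++ q ∧ q <+: b := by
  obtain ⟨t, ht⟩ := h
  obtain ⟨q, h₁, h₂⟩ | ⟨q, h₁, h₂⟩ := List.append_eq_append_iff.1 ht
  · exact Or.inl ⟨q, h₁.symm⟩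
  · exact Or.inr ⟨q, h₁, t, h₂.symm⟩

/-! ### Cancellation and quasiconvex subgroups of free groups. -/

namespace FreeGroup

/-- A word all of whose prefixes represent cosets from a finite set `S` can be shortened, without
changing its coset, to length at most the size of `S`. -/
theorem exists_length_le_card {α X : Type*} (J : Subgroup (FreeGroup α))
    (c : FreeGroup α → X) (hc : ∀ g g', c g = c g' ↔ g * g'⁻¹ ∈ J) (S : Finset X)
    (v : List (α × Bool)) (hv : ∀ p, p <+: v → c (mk p) ∈ S) :
    ∃ v' : List (α × Bool), v'.length ≤ S.card ∧ c (mk v) = c (mk v') := by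
  induction hn : v.length using Nat.strong_induction_on generalizing v with
  | _ n ih =>
  by_cases hle : v.length ≤ S.card
  · exact ⟨v, hle, rfl⟩
  -- Pigeonhole on proper prefixes: two of them lie in the same coset, and the segment between them
  -- can be cut out, since right multiplication respects right cosets.
  obtain ⟨i, hi, j, hj, hne, hij⟩ := Finset.exists_ne_map_eq_of_card_lt_of_maps_to
    (s := Finset.range v.length) (t := S) (f := fun i => c (mk (v.take i)))
    (by simpa using hle) (fun i _ => hv _ (List.take_prefix _ _))
  wlog hlt : i < j generalizing i j
  · exact this j hj i hi hne.symm hij.symm (by omega)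
  simp only [Finset.mem_range] at hi hj
  have hcong : ∀ q, c (mk (v.take i ++ q)) = c (mk (v.take j ++ q)) := by
    intro q
    rw [hc] at hij ⊢
    rw [← mul_mk, ← mul_mk]
    convert hij using 1
    group
  obtain ⟨v', h₁, h₂⟩ := ih (v.take i ++ v.drop j).length
    (by simp; omega) (v.take i ++ v.drop j) (by
      intro p hp
      obtain hp | ⟨q, rfl, hq⟩ := hp.of_append
      · exact hv p (hp.trans (List.take_prefix _ _))
      · rw [hcong]
        refine hv _ ?_
        conv_rhs => rw [← List.take_append_drop j v]
        exact (List.prefix_append_right_inj _).2 hq) rfl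
  refine ⟨v', h₁, ?_⟩
  rw [← h₂, hcong, List.take_append_drop]

variable {α : Type*} [DecidableEq α]

/-- Writing `g` and `h` as reduced words, their product is obtained by cancelling a suffix of `g`
against a prefix of `h`. -/
theorem exists_toWord_mul_eq (g h : FreeGroup α) :
    ∃ p s q : List (α × Bool), g.toWord = p ++ s ∧ h.toWord = invRev s ++ q ∧
      (g * h).toWord = p ++ q := by
  suffices H : ∀ (l r : List (α × Bool)), IsReduced l → IsReduced r →
      ∃ p s q : List (α × Bool), l = p ++ s ∧ r = invRev s ++ q ∧ IsReduced (p ++ q) by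
    obtain ⟨p, s, q, h₁, h₂, h₃⟩ := H g.toWord h.toWord isReduced_toWord isReduced_toWord
    refine ⟨p, s, q, h₁, h₂, ?_⟩
    rw [← h₃.reduce_eq, ← toWord_mk]
    congr 1
    rw [← mk_toWord (x := g), ← mk_toWord (x := h), h₁, h₂, ← mul_mk, ← mul_mk, ← mul_mk, ← inv_mk]
    group
  intro l
  induction l using List.reverseRecOn with
  | nil => intro r _ hr; exact ⟨[], [], r, by simp, by simp, by simpa using hr⟩
  | append_singleton l a ih =>
    intro r hl hr
    cases r with
    | nil => exact ⟨l ++ [a], [], [], by simp, by simp, by simpa using hl⟩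
    | cons b r =>
      by_cases hab : b = (a.1, !a.2)
      · obtain ⟨p, s, q, h₁, h₂, h₃⟩ := ih r (hl.infix ⟨[], [a], by simp⟩)
          (hr.infix ⟨[b], [], by simp⟩)
        refine ⟨p, s ++ [a], q, by simp [h₁], by simp [h₂, hab, invRev], h₃⟩
      · refine ⟨l ++ [a], [], b :: r, by simp, by simp, ?_⟩
        have : IsReduced ([a] ++ b :: r) := by
          refine List.isChain_cons_cons.2 ⟨?_, hr⟩
          intro h1
          by_contra h2
          exact hab (Prod.ext h1.symm (by cases h : a.2 <;> cases h' : b.2 <;> simp_all))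
        simpa using IsReduced.append_overlap hl this (by simp)

theorem norm_eq_length (g : FreeGroup α) : g.norm = g.toWord.length := rfl

/-- Every prefix of the reduced form of an element of `H` lies in a right coset of `H` that has a
representative of norm at most `R`. -/
def Quasiconvex (H : Subgroup (FreeGroup α)) (R : ℕ) : Prop :=
  ∀ h ∈ H, ∀ p, p <+: h.toWord → ∃ t : FreeGroup α, t.norm ≤ R ∧ mk p * t⁻¹ ∈ H

/-- The constant does not grow under products: a prefix of the reduced form of `gh` is either a
prefix of `g`, or `g` times a prefix of `h`. For inverses, a prefix of `g⁻¹` is `g⁻¹` times a prefix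
of `g`. -/
theorem Quasiconvex.of_closure {S : Set (FreeGroup α)} {R : ℕ} (hS : ∀ s ∈ S, s.norm ≤ R) :
    Quasiconvex (Subgroup.closure S) R := by
  intro h hh
  induction hh using Subgroup.closure_induction with
  | mem x hx =>
    intro p hp
    refine ⟨mk p, ?_, by rw [mul_inv_cancel]; exact one_mem _⟩
    exact norm_mk_le.trans (hp.length_le.trans (hS x hx))
  | one =>
    intro p hp
    refine ⟨1, by simp, ?_⟩
    have : p = [] := by simpa using hp
    simp [this, ← one_eq_mk]
  | mul g h hg hh ihg ihh =>
    intro p hp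
    obtain ⟨a, s, b, h₁, h₂, h₃⟩ := exists_toWord_mul_eq g h
    rw [h₃] at hp
    obtain hp | ⟨q, rfl, hq⟩ := hp.of_append
    · exact ihg p (hp.trans (h₁ ▸ List.prefix_append _ _))
    · obtain ⟨t, ht, hm⟩ := ihh (invRev s ++ q) (by rw [h₂]; exact (List.prefix_append_right_inj _).2 hq)
      refine ⟨t, ht, ?_⟩
      have : mk (a ++ q) = g * mk (invRev s ++ q) := by
        rw [← mk_toWord (x := g), h₁, ← mul_mk, ← mul_mk, ← mul_mk, ← inv_mk]; group
      rw [this, mul_assoc]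
      exact mul_mem hg hm
  | inv g hg ih =>
    intro p hp
    obtain ⟨r, hr⟩ := hp
    rw [toWord_inv] at hr
    have hg' : g.toWord = invRev r ++ invRev p := by
      rw [← invRev_append, hr, invRev_invRev]
    obtain ⟨t, ht, hm⟩ := ih (invRev r) (hg' ▸ List.prefix_append _ _)
    refine ⟨t, ht, ?_⟩
    have : mk p = g⁻¹ * mk (invRev r) := by
      rw [← mk_toWord (x := g), hg', ← mul_mk, ← inv_mk, ← inv_mk]; group
    rw [this, mul_assoc]
    exact mul_mem (inv_mem hg) hm

/-- Read `h` letter by letter, keeping a coset representative of norm at most `R`. Reading the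
letter `x` while passing from `t` to `t'` contributes the factor `t x t'⁻¹ ∈ H`, of norm at most `R
+ 1 + R`; the last representative itself lies in `H`. -/
theorem Quasiconvex.closure_eq {H : Subgroup (FreeGroup α)} {R : ℕ} (hH : Quasiconvex H R) :
    H = Subgroup.closure {h | h ∈ H ∧ h.norm ≤ 2 * R + 1} := by
  refine le_antisymm ?_ ((Subgroup.closure_le _).2 fun h hh => hh.1)
  set K := Subgroup.closure {h | h ∈ H ∧ h.norm ≤ 2 * R + 1} with hK
  have hKH : K ≤ H := (Subgroup.closure_le _).2 fun h hh => hh.1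
  intro h hh
  have key : ∀ p, p <+: h.toWord → ∃ t : FreeGroup α, t.norm ≤ R ∧ mk p * t⁻¹ ∈ K := by
    intro p
    induction p using List.reverseRecOn with
    | nil => intro _; exact ⟨1, by simp, by simp [← one_eq_mk]⟩
    | append_singleton p x ih =>
      intro hp
      obtain ⟨t, ht, hm⟩ := ih ((List.prefix_append _ _).trans hp)
      obtain ⟨t', ht', hm'⟩ := hH h hh _ hp
      refine ⟨t', ht', ?_⟩
      have e : mk (p ++ [x]) * t'⁻¹ = (mk p * t⁻¹) * (t * mk [x] * t'⁻¹) := by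
        rw [← mul_mk]; group
      rw [e]
      refine mul_mem hm (Subgroup.subset_closure ⟨?_, ?_⟩)
      · rw [e] at hm'
        exact (H.mul_mem_cancel_left (hKH hm)).1 hm'
      · have h1 := norm_mul_le (t * mk [x]) t'⁻¹
        have h2 := norm_mul_le t (mk [x])
        have h3 : (mk [x]).norm ≤ 1 := norm_mk_le
        rw [norm_inv_eq] at h1
        omega
  obtain ⟨t, ht, hm⟩ := key _ List.prefix_rfl
  rw [mk_toWord] at hm
  have htH : t ∈ H := by
    have := (H.mul_mem_cancel_left hh).1 (hKH hm)
    simpa using this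
  have htK : t ∈ K := Subgroup.subset_closure ⟨htH, by omega⟩
  simpa using mul_mem hm htK

/-- Effective Howson theorem: a coset of `H ⊓ K` is determined by its coset of `H` and its coset of
`K`, so prefixes of elements of the intersection meet at most `B₁.card * B₂.card` cosets, and
`exists_length_le_card` supplies short representatives. -/
theorem Quasiconvex.inf {H K : Subgroup (FreeGroup α)} {R S : ℕ} (hH : Quasiconvex H R)
    (hK : Quasiconvex K S) {B₁ B₂ : Finset (FreeGroup α)} (hB₁ : ∀ t : FreeGroup α, t.norm ≤ R → t ∈ B₁)
    (hB₂ : ∀ t : FreeGroup α, t.norm ≤ S → t ∈ B₂) : Quasiconvex (H ⊓ K) (B₁.card * B₂.card) := by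
  classical
  intro h hh p hp
  let c : FreeGroup α → Quotient (QuotientGroup.rightRel (H ⊓ K)) := fun g => Quotient.mk _ g
  have hc : ∀ g g', c g = c g' ↔ g * g'⁻¹ ∈ H ⊓ K := by
    intro g g'
    rw [eq_comm]
    simp only [c]
    rw [Quotient.eq]
    exact QuotientGroup.rightRel_apply
  -- An element common to the cosets `H t.1` and `K t.2`; the default `1` only concerns pairs with
  -- disjoint cosets, which no prefix produces.
  let pick : FreeGroup α × FreeGroup α → FreeGroup α := fun t =>
    if h : ∃ g, g * t.1⁻¹ ∈ H ∧ g * t.2⁻¹ ∈ K then h.choose else 1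
  obtain ⟨v', h₁, h₂⟩ := exists_length_le_card (H ⊓ K) c hc
    ((B₁ ×ˢ B₂).image fun t => c (pick t)) p (by
      intro q hq
      obtain ⟨t, ht, hmt⟩ := hH h hh.1 q (hq.trans hp)
      obtain ⟨s, hs, hms⟩ := hK h hh.2 q (hq.trans hp)
      refine Finset.mem_image.2 ⟨(t, s), Finset.mk_mem_product (hB₁ t ht) (hB₂ s hs), ?_⟩
      have hex : ∃ g, g * (t, s).1⁻¹ ∈ H ∧ g * (t, s).2⁻¹ ∈ K := ⟨mk q, hmt, hms⟩
      simp only [pick, dif_pos hex]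
      obtain ⟨k₁, k₂⟩ := hex.choose_spec
      rw [hc]
      refine ⟨?_, ?_⟩
      · have := mul_mem k₁ (inv_mem hmt)
        simpa [mul_assoc] using this
      · have := mul_mem k₂ (inv_mem hms)
        simpa [mul_assoc] using this)
  refine ⟨mk v', ?_, (hc _ _).1 h₂⟩
  calc (mk v').norm ≤ v'.length := norm_mk_le
    _ ≤ _ := h₁
    _ ≤ _ := Finset.card_image_le
    _ = _ := Finset.card_product _ _

/-- If a nontrivial `u` is conjugated into `H` by `a`, then the coset `H a` has a representative
whose norm is bounded in terms of `u`. -/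
theorem Quasiconvex.exists_norm_le_of_conj_mem {H : Subgroup (FreeGroup α)} {R : ℕ}
    (hH : Quasiconvex H R) {u : FreeGroup α} (hu : u ≠ 1) (a : FreeGroup α)
    (ha : a * u * a⁻¹ ∈ H) : ∃ a', a'.norm ≤ R + u.norm ∧ a * a'⁻¹ ∈ H := by
  -- Take `b` shortest in `H a`. Since `b u` and `b u⁻¹` lie in the same coset, neither is shorter
  -- than `b`, so on each side of `b u b⁻¹` at most half of `u` cancels.
  obtain ⟨b, hb, hmin⟩ : ∃ b, a * b⁻¹ ∈ H ∧ ∀ b', a * b'⁻¹ ∈ H → b.norm ≤ b'.norm := by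
    obtain ⟨b, hb, hm⟩ := WellFounded.has_min (InvImage.wf (norm (α := α)) Nat.lt_wfRel.wf)
      {b : FreeGroup α | a * b⁻¹ ∈ H} ⟨a, by simp⟩
    exact ⟨b, hb, fun b' hb' => not_lt.1 (hm b' hb')⟩
  have hbu : b * u * b⁻¹ ∈ H := by
    have := mul_mem (mul_mem (inv_mem hb) ha) hb
    convert this using 1
    group
  obtain ⟨p, s, q, h₁, h₂, h₃⟩ := exists_toWord_mul_eq b u
  obtain ⟨p', s', q', k₁, k₂, k₃⟩ := exists_toWord_mul_eq u b⁻¹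
  have m₁ := hmin (b * u) (by
    have := mul_mem hb (inv_mem hbu); convert this using 1; group)
  have m₂ := hmin (u * b⁻¹)⁻¹ (by
    have := mul_mem hb hbu; convert this using 1; group)
  rw [norm_inv_eq] at m₂
  have hbw : b.toWord = invRev q' ++ s' := by
    rw [toWord_inv] at k₂
    rw [← invRev_invRev (L₁ := b.toWord), k₂, invRev_append, invRev_invRev]
  simp only [norm_eq_length, h₃, k₃] at m₁ m₂
  have l₁ := congrArg List.length h₁
  have l₂ := congrArg List.length h₂
  have l₃ := congrArg List.length k₁
  have l₄ := congrArg List.length hbw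
  simp only [List.length_append, invRev_length] at l₁ l₂ l₃ l₄ m₁ m₂
  have hps : (invRev s) <+: p' := by
    refine List.prefix_of_prefix_length_le (l₃ := u.toWord) (h₂ ▸ List.prefix_append _ _)
      (k₁ ▸ List.prefix_append _ _) ?_
    rw [invRev_length]; omega
  obtain ⟨z, hz⟩ := hps
  -- Here `z` is the part of `u` surviving both cancellations. Were it empty, `s` and `s'` would be
  -- suffixes of `b` of equal length, hence equal, and `u = s⁻¹ s = 1`.
  have hz0 : z ≠ [] := by
    rintro rfl
    rw [List.append_nil] at hz
    subst hz
    rw [invRev_length] at l₃ m₂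
    have hss : s = s' := by
      have e : p ++ s = invRev q' ++ s' := h₁.symm.trans hbw
      exact (List.append_inj' e (by omega)).2
    refine hu ?_
    rw [← mk_toWord (x := u), k₁, ← hss, ← mul_mk, ← inv_mk]
    exact inv_mul_cancel _
  have hq : q = z ++ s' := by
    have e : invRev s ++ q = invRev s ++ (z ++ s') := by
      rw [← List.append_assoc, hz, ← k₁, h₂]
    exact List.append_cancel_left e
  have r₁ : IsReduced (p ++ z) := by
    have : IsReduced (p ++ q) := h₃ ▸ isReduced_toWord
    exact this.infix ⟨[], s', by simp [hq]⟩
  have r₂ : IsReduced (z ++ q') := by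
    have : IsReduced (p' ++ q') := k₃ ▸ isReduced_toWord
    exact this.infix ⟨invRev s, [], by simp [← hz]⟩
  have hw : (b * u * b⁻¹).toWord = p ++ z ++ q' := by
    rw [← (IsReduced.append_overlap r₁ r₂ hz0).reduce_eq, ← toWord_mk]
    congr 1
    rw [mul_assoc, ← mk_toWord (x := u * b⁻¹), k₃, ← hz, ← mk_toWord (x := b), h₁]
    simp only [← mul_mk, ← inv_mk]
    group
  -- Since `p` is now a prefix of an element of `H`, it can be replaced by a short `t` without
  -- leaving its coset; the remaining part `s` of `b` was cancelled against `u` and is no longer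
  -- than `u`.
  obtain ⟨t, ht, hm⟩ := hH _ hbu p (by rw [hw, List.append_assoc]; exact List.prefix_append _ _)
  refine ⟨t * mk s, ?_, ?_⟩
  · have := norm_mul_le t (mk s)
    have hs : (mk s).norm ≤ s.length := norm_mk_le
    rw [norm_eq_length u]
    omega
  · have := mul_mem hb hm
    convert this using 1
    rw [← mk_toWord (x := b), h₁, ← mul_mk]
    group

end FreeGroup

/-! ### Enumeration of short words and primitive recursive operations on words. -/

/-- All lists of length at most `n` over a finite type. -/
noncomputable def listsUpTo (β : Type*) [Fintype β] : ℕ → List (List β)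
  | 0 => [[]]
  | n + 1 => [] :: (listsUpTo β n).flatMap fun l => Finset.univ.toList.map fun b => b :: l

theorem mem_listsUpTo {β : Type*} [Fintype β] {n : ℕ} {l : List β} (h : l.length ≤ n) :
    l ∈ listsUpTo β n := by
  induction n generalizing l with
  | zero => simpa [listsUpTo] using h
  | succ n ih =>
    cases l with
    | nil => simp [listsUpTo]
    | cons b l =>
      simp only [List.length_cons, Nat.add_le_add_iff_right] at h
      simpa [listsUpTo] using ih h

theorem Primrec.listsUpTo (β : Type*) [Fintype β] [Primcodable β] :
    Primrec (listsUpTo β) := by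
  have : Primrec₂ fun (_ : ℕ) (p : ℕ × List (List β)) =>
      [] :: p.2.flatMap fun l => Finset.univ.toList.map fun b : β => b :: l := by
    refine Primrec.list_cons.comp (Primrec.const []) ?_
    refine Primrec.list_flatMap (Primrec.snd.comp Primrec.snd) ?_
    exact Primrec.list_map (Primrec.const _) (Primrec.list_cons.comp Primrec.snd
      (Primrec.snd.comp Primrec.fst))
  refine (Primrec.nat_rec' .id (.const [[]]) this).of_eq fun n => ?_
  induction n with
  | zero => rfl
  | succ n ih =>
    simp only [id] at ih ⊢
    rw [ih]
    rfl

namespace FreeGroup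

theorem primrec_reduce {α : Type*} [DecidableEq α] [Primcodable α] :
    Primrec (reduce : List (α × Bool) → List (α × Bool)) := by
  have step : Primrec₂ fun (_ : List (α × Bool)) (p : (α × Bool) × List (α × Bool)) =>
      (List.casesOn p.2 [p.1] fun hd tl =>
        if p.1.1 = hd.1 ∧ p.1.2 = !hd.2 then tl else p.1 :: hd :: tl : List (α × Bool)) := by
    refine Primrec.list_casesOn (h := fun (z : List (α × Bool) × (α × Bool) × List (α × Bool))
        (y : (α × Bool) × List (α × Bool)) =>
        if z.2.1.1 = y.1.1 ∧ z.2.1.2 = !y.1.2 then y.2 else z.2.1 :: y.1 :: y.2)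
      (Primrec.snd.comp Primrec.snd)
      (Primrec.list_cons.comp (Primrec.fst.comp Primrec.snd) (Primrec.const [])) ?_
    have p1 : Primrec fun z : (List (α × Bool) × (α × Bool) × List (α × Bool)) ×
        (α × Bool) × List (α × Bool) => z.1.2.1 :=
      Primrec.fst.comp (Primrec.snd.comp Primrec.fst)
    have hd : Primrec fun z : (List (α × Bool) × (α × Bool) × List (α × Bool)) ×
        (α × Bool) × List (α × Bool) => z.2.1 := Primrec.fst.comp Primrec.snd
    have tl : Primrec fun z : (List (α × Bool) × (α × Bool) × List (α × Bool)) ×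
        (α × Bool) × List (α × Bool) => z.2.2 := Primrec.snd.comp Primrec.snd
    refine Primrec.ite (PrimrecPred.and ?_ ?_) tl
      (Primrec.list_cons.comp p1 (Primrec.list_cons.comp hd tl))
    · exact Primrec.eq.comp (Primrec.fst.comp p1) (Primrec.fst.comp hd)
    · exact Primrec.eq.comp (Primrec.snd.comp p1) (Primrec.not.comp (Primrec.snd.comp hd))
  refine (Primrec.list_foldr Primrec.id (Primrec.const []) step).of_eq fun l => ?_
  induction l with
  | nil => rfl
  | cons a l ih =>
    rw [reduce.cons]
    simp only [id, List.foldr_cons] at ih ⊢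
    rw [ih]

theorem primrec_invRev {α : Type*} [Primcodable α] :
    Primrec (invRev : List (α × Bool) → List (α × Bool)) :=
  Primrec.list_reverse.comp (Primrec.list_map Primrec.id
    (Primrec.pair (Primrec.fst.comp Primrec.snd)
      (Primrec.not.comp (Primrec.snd.comp Primrec.snd))))

section Substitution

variable {β α : Type*} [DecidableEq α]

/-- The image of a word under a homomorphism of free groups, computed letter by letter. -/
def substWord (f : FreeGroup β →* FreeGroup α) (w : List (β × Bool)) : List (α × Bool) :=
  w.flatMap fun x => (f (mk [x])).toWord

theorem mk_substWord (f : FreeGroup β →* FreeGroup α) (w : List (β × Bool)) :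
    mk (substWord f w) = f (mk w) := by
  induction w with
  | nil => simp [substWord, ← one_eq_mk]
  | cons x w ih =>
    have e : (mk (x :: w) : FreeGroup β) = mk [x] * mk w := by rw [mul_mk]; rfl
    rw [e, _root_.map_mul, ← ih, ← mk_toWord (x := f (mk [x])), mul_mk]
    simp [substWord]

theorem primrec_substWord [Finite β] [Primcodable β] [Primcodable α]
    (f : FreeGroup β →* FreeGroup α) : Primrec (substWord f) :=
  Primrec.list_flatMap Primrec.id ((Primrec.dom_finite fun x : β × Bool =>
    (f (mk [x])).toWord).comp Primrec.snd)

theorem exists_length_substWord_le [Finite β] (f : FreeGroup β →* FreeGroup α) :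
    ∃ K, ∀ w, (substWord f w).length ≤ K * w.length := by
  obtain ⟨K, hK⟩ := Finite.exists_le fun x : β × Bool => (f (mk [x])).toWord.length
  refine ⟨K, fun w => ?_⟩
  induction w with
  | nil => simp [substWord]
  | cons x w ih =>
    have := hK x
    simp only [substWord, List.flatMap_cons, List.length_append, List.length_cons, mul_add,
      mul_one] at ih ⊢
    omega

theorem exists_norm_map_le [Finite β] (f : FreeGroup β →* FreeGroup α) :
    ∃ K, ∀ w, (f (mk w)).norm ≤ K * w.length := by
  obtain ⟨K, hK⟩ := exists_length_substWord_le f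
  exact ⟨K, fun w => by rw [← mk_substWord]; exact norm_mk_le.trans (hK w)⟩

theorem Quasiconvex.mono {H : Subgroup (FreeGroup α)} {R S : ℕ} (h : Quasiconvex H R)
    (hRS : R ≤ S) : Quasiconvex H S := fun g hg p hp =>
  let ⟨t, ht, hm⟩ := h g hg p hp
  ⟨t, ht.trans hRS, hm⟩

theorem exists_quasiconvex_range [Finite β] (f : FreeGroup β →* FreeGroup α) :
    ∃ R, Quasiconvex f.range R := by
  obtain ⟨R, hR⟩ := Finite.exists_le fun x : β => (f (of x)).norm
  refine ⟨R, ?_⟩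
  have : f.range = Subgroup.closure (f '' Set.range of) := by
    rw [← MonoidHom.map_closure, closure_range_of, MonoidHom.range_eq_map]
  rw [this]
  refine Quasiconvex.of_closure ?_
  rintro _ ⟨_, ⟨x, rfl⟩, rfl⟩
  exact hR x

theorem exists_section {G : Type*} [Group G] (e : FreeGroup β →* G)
    (he : Function.Surjective e) {γ : Type*} (f : FreeGroup γ →* G) :
    ∃ j : FreeGroup γ →* FreeGroup β, ∀ g, e (j g) = f g := by
  choose s hs using he
  refine ⟨lift fun c => s (f (of c)), fun g => ?_⟩
  have : e.comp (lift fun c => s (f (of c))) = f := by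
    ext c; simp [hs]
  exact DFunLike.congr_fun this g

end Substitution

/-! ### Membership and preimages by finite automata. -/

/-- A finite transducer that decides membership of a reduced word in the image of a homomorphism
of free groups and computes a preimage. -/
theorem exists_transducer {α β : Type*} [DecidableEq α] [Fintype α] [Primcodable α]
    [Primcodable β] (f : FreeGroup β →* FreeGroup α) {R : ℕ} (hR : Quasiconvex f.range R) :
    ∃ ρ : List (α × Bool) → Option (List (β × Bool)), Primrec ρ ∧
      (∀ v l, ρ v = some l → f (mk l) = mk v) ∧
      (∀ g ∈ f.range, ∃ l, ρ (toWord g) = some l) ∧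
      ∃ M, ∀ v l, ρ v = some l → l.length ≤ M * (v.length + 1) := by
  classical
  let L := listsUpTo (α × Bool) R
  let Q := Fin L.length
  let val : Q → FreeGroup α := fun i => mk (L.get i)
  have hval : ∀ t : FreeGroup α, t.norm ≤ R → ∃ i, val i = t := by
    intro t ht
    obtain ⟨i, hi⟩ := List.get_of_mem (mem_listsUpTo (β := α × Bool) (l := t.toWord) ht)
    exact ⟨i, by simp only [val]; rw [show L.get i = t.toWord from hi, mk_toWord]⟩
  obtain ⟨q₀, hq₀⟩ := hval 1 (by simp)
  -- States are coset representatives of norm at most `R`. Reading a letter moves to a new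
  -- representative and emits a preimage of the correction factor. The tables `δ` and `τ` are chosen
  -- classically, but have finite domain and hence are primitive recursive.
  let P : Q × (α × Bool) → Q × List (β × Bool) → Prop := fun s r =>
    f (mk r.2) * val r.1 = val s.1 * mk [s.2]
  let δ : Q × (α × Bool) → Option (Q × List (β × Bool)) := fun s =>
    if h : ∃ r, P s r then some h.choose else none
  have hδ : ∀ s r, δ s = some r → P s r := by
    intro s r h
    simp only [δ] at h
    split_ifs at h with hs
    cases h
    exact hs.choose_spec
  have hδ' : ∀ s, (∃ r, P s r) → ∃ r, δ s = some r := by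
    intro s hs
    exact ⟨hs.choose, by simp only [δ, dif_pos hs]⟩
  let τ : Q → Option (List (β × Bool)) := fun q =>
    if h : ∃ l, f (mk l) = val q then some h.choose else none
  have hτ : ∀ q l, τ q = some l → f (mk l) = val q := by
    intro q l h
    simp only [τ] at h
    split_ifs at h with hs
    cases h
    exact hs.choose_spec
  let step : Option (Q × List (β × Bool)) → α × Bool → Option (Q × List (β × Bool)) := fun o x =>
    o.bind fun s => (δ (s.1, x)).map fun r => (r.1, s.2 ++ r.2)
  let run : List (α × Bool) → Option (Q × List (β × Bool)) := fun v =>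
    v.foldl step (some (q₀, []))
  let ρ : List (α × Bool) → Option (List (β × Bool)) := fun v =>
    (run v).bind fun s => (τ s.1).map fun l => s.2 ++ l
  have run_append : ∀ v x, run (v ++ [x]) = step (run v) x := fun v x => by simp [run]
  have step_some : ∀ o x r, step o x = some r → ∃ s t, o = some s ∧ δ (s.1, x) = some t ∧
      r = (t.1, s.2 ++ t.2) := by
    intro o x r h
    simp only [step, Option.bind_eq_some_iff, Option.map_eq_some_iff] at h
    obtain ⟨s, hs, t, ht, rfl⟩ := h
    exact ⟨s, t, hs, ht, rfl⟩
  have ρ_some : ∀ v l, ρ v = some l → ∃ s t, run v = some s ∧ τ s.1 = some t ∧ l = s.2 ++ t := by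
    intro v l h
    simp only [ρ, Option.bind_eq_some_iff, Option.map_eq_some_iff] at h
    obtain ⟨s, hs, t, ht, rfl⟩ := h
    exact ⟨s, t, hs, ht, rfl⟩
  have run_sound : ∀ v s, run v = some s → f (mk s.2) * val s.1 = mk v := by
    intro v
    induction v using List.reverseRecOn with
    | nil =>
      intro s hs
      obtain rfl : (q₀, []) = s := by simpa [run] using hs
      simp [hq₀, ← one_eq_mk]
    | append_singleton v x ih =>
      intro s hs
      rw [run_append] at hs
      obtain ⟨s', t, h₁, h₂, rfl⟩ := step_some _ _ _ hs
      have := hδ _ _ h₂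
      simp only [P] at this
      rw [← mul_mk, _root_.map_mul, mul_assoc, this, ← mul_assoc, ih _ h₁, mul_mk]
  refine ⟨ρ, ?_, ?_, ?_, ?_⟩
  · have hrun : Primrec run := by
      refine Primrec.list_foldl (h := fun _ p => step p.1 p.2) Primrec.id
        (Primrec.const (some (q₀, []))) ?_
      refine Primrec.option_bind (Primrec.fst.comp Primrec.snd) ?_
      refine Primrec.option_map ((Primrec.dom_finite δ).comp (Primrec.pair
        (Primrec.fst.comp Primrec.snd) (Primrec.snd.comp (Primrec.snd.comp Primrec.fst)))) ?_
      exact Primrec.pair (Primrec.fst.comp Primrec.snd) (Primrec.list_append.comp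
        (Primrec.snd.comp (Primrec.snd.comp Primrec.fst)) (Primrec.snd.comp Primrec.snd))
    refine Primrec.option_bind hrun ?_
    refine Primrec.option_map ((Primrec.dom_finite τ).comp (Primrec.fst.comp Primrec.snd)) ?_
    exact Primrec.list_append.comp
        (Primrec.snd.comp (Primrec.snd.comp Primrec.fst)) Primrec.snd
  · intro v l h
    obtain ⟨s, t, h₁, h₂, rfl⟩ := ρ_some _ _ h
    rw [← mul_mk, _root_.map_mul, hτ _ _ h₂, run_sound _ _ h₁]
  · intro g hg
    have key : ∀ v, v <+: g.toWord → ∃ s, run v = some s := by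
      intro v
      induction v using List.reverseRecOn with
      | nil => exact fun _ => ⟨_, rfl⟩
      | append_singleton v x ih =>
        intro hv
        obtain ⟨s, hs⟩ := ih ((List.prefix_append _ _).trans hv)
        have h₁ := run_sound _ _ hs
        -- Quasiconvexity guarantees that some transition is available, whatever earlier choices `δ`
        -- made: the invariant `run_sound` fixes the current coset.
        obtain ⟨t, ht, y, hy⟩ := hR g hg _ hv
        obtain ⟨q, hq⟩ := hval t ht
        obtain ⟨r, hr⟩ := hδ' (s.1, x) ⟨(q, ((mk s.2)⁻¹ * y).toWord), by
          simp only [P]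
          rw [mk_toWord, hq, _root_.map_mul, hy, _root_.map_inv, ← mul_mk, ← h₁]
          group⟩
        refine ⟨(r.1, s.2 ++ r.2), ?_⟩
        rw [run_append, hs]
        simp [step, hr]
    obtain ⟨s, hs⟩ := key _ List.prefix_rfl
    have h₁ := run_sound _ _ hs
    obtain ⟨y, hy⟩ := hg
    have hex : ∃ l, f (mk l) = val s.1 := by
      refine ⟨((mk s.2)⁻¹ * y).toWord, ?_⟩
      rw [mk_toWord, _root_.map_mul, hy, _root_.map_inv, ← mk_toWord (x := g), ← h₁]
      group
    refine ⟨s.2 ++ hex.choose, ?_⟩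
    simp only [ρ, hs, τ, Option.bind_some, dif_pos hex, Option.map_some]
  · obtain ⟨M₁, hM₁⟩ := Finite.exists_le fun s => ((δ s).map fun r => r.2.length).getD 0
    obtain ⟨M₂, hM₂⟩ := Finite.exists_le fun s => ((τ s).map fun r => r.length).getD 0
    have key : ∀ v s, run v = some s → s.2.length ≤ M₁ * v.length := by
      intro v
      induction v using List.reverseRecOn with
      | nil =>
        intro s hs
        obtain rfl : (q₀, []) = s := by simpa [run] using hs
        simp
      | append_singleton v x ih =>
        intro s hs
        rw [run_append] at hs
        obtain ⟨s', t, h₁, h₂, rfl⟩ := step_some _ _ _ hs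
        have a := ih _ h₁
        have b := hM₁ (s'.1, x)
        rw [h₂] at b
        simp only [Option.map_some, Option.getD_some] at b
        simp only [List.length_append, List.length_singleton, mul_add, mul_one]
        omega
    refine ⟨M₁ + M₂, fun v l h => ?_⟩
    obtain ⟨s, t, h₁, h₂, rfl⟩ := ρ_some _ _ h
    have a := key _ _ h₁
    have b := hM₂ s.1
    rw [h₂] at b
    simp only [Option.map_some, Option.getD_some] at b
    rw [List.length_append]
    nlinarith [Nat.zero_le (M₂ * v.length)]

end FreeGroup

-- Homomorphisms from the free group on `X` to `ZMod 2` are the functions on `X`. By surjectivity of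
-- `e` they are determined by their values on the images of the finite set `β`, so there are
-- finitely many.
open FreeGroup in
theorem finite_of_surjective_freeGroup {β X : Type*} [Finite β] (e : FreeGroup β →* FreeGroup X)
    (he : Function.Surjective e) : Finite X := by
  have h₁ : Finite (X → Multiplicative (ZMod 2)) := by
    refine Finite.of_injective (β := β → Multiplicative (ZMod 2))
      (fun g b => lift g (e (of b))) fun g g' h => ?_
    have : (lift g).comp e = (lift g').comp e := by
      ext b; exact congrFun h b
    have h' : lift g = lift g' := by
      ext x
      obtain ⟨y, hy⟩ := he (of x)
      rw [← hy]
      exact DFunLike.congr_fun this y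
    exact lift.injective h'
  classical
  refine Finite.of_injective (fun x : X => (Pi.mulSingle x (Multiplicative.ofAdd (1 : ZMod 2)) :
    X → Multiplicative (ZMod 2))) fun x y h => ?_
  by_contra hne
  have := congrFun h x
  simp only [Pi.mulSingle_eq_same, Pi.mulSingle_eq_of_ne hne] at this
  exact absurd this (by decide)

theorem IsFreeGroup.exists_mulEquiv_fin {β H : Type*} [Finite β] [Group H] [IsFreeGroup H]
    (e : FreeGroup β →* H) (he : Function.Surjective e) :
    ∃ r : ℕ, Nonempty (H ≃* FreeGroup (Fin r)) := by
  have := finite_of_surjective_freeGroup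
    ((IsFreeGroup.toFreeGroup H).toMonoidHom.comp e)
    ((IsFreeGroup.toFreeGroup H).surjective.comp he)
  obtain ⟨r, ⟨f⟩⟩ := Finite.exists_equiv_fin (IsFreeGroup.Generators H)
  exact ⟨r, ⟨(IsFreeGroup.toFreeGroup H).trans (FreeGroup.freeGroupCongr f)⟩⟩

/-! ### Algorithmic data for one free factor. -/

/-- The subgroup `D` is generated by elements represented by words of length at most `N`. -/
def GeneratedByShort {Γ : Type*} {C : Type*} [Group C] (k : FreeGroup Γ →* C) (N : ℕ)
    (D : Subgroup C) : Prop :=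
  D ≤ Subgroup.closure {c | c ∈ D ∧ ∃ l : List (Γ × Bool), l.length ≤ N ∧ k (FreeGroup.mk l) = c}

/-- The elements `c` with `θ c ∈ g (θ D) g⁻¹`. -/
def conjPullback {C H : Type*} [Group C] [Group H] (θ : C →* H) (g : H) (D : Subgroup C) :
    Subgroup C :=
  ((D.map θ).map (MulAut.conj g).toMonoidHom).comap θ

theorem mem_conjPullback {C H : Type*} [Group C] [Group H] {θ : C →* H} {g : H} {D : Subgroup C}
    {c : C} : c ∈ conjPullback θ g D ↔ ∃ d ∈ D, g⁻¹ * θ c * g = θ d := by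
  simp only [conjPullback, Subgroup.mem_comap, Subgroup.mem_map, MulEquiv.coe_toMonoidHom,
    MulAut.conj_apply, exists_exists_and_eq_and]
  refine exists_congr fun d => and_congr_right fun _ => ?_
  constructor
  · intro h; rw [← h]; group
  · intro h; rw [← h]; group

/-- Algorithmic data for a homomorphism `θ : C →* H` of groups whose elements are represented by
words via `k` and `e`. -/
structure FactorAlgorithm {Λ Γ : Type} [Primcodable Λ] [Primcodable Γ] {H C : Type*} [Group H]
    [Group C] (e : FreeGroup Λ →* H) (k : FreeGroup Γ →* C) (θ : C →* H) where
  /-- Decides membership in the range of `θ` and computes preimages. -/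
  rewrite : List (Λ × Bool) → Option (List (Γ × Bool))
  primrec_rewrite : Primrec rewrite
  eval_of_rewrite_eq_some : ∀ {w l}, rewrite w = some l → e (FreeGroup.mk w) = θ (k (FreeGroup.mk l))
  notMem_of_rewrite_eq_none : ∀ {w}, rewrite w = none → e (FreeGroup.mk w) ∉ θ.range
  /-- Computes `θ` on words. -/
  incl : List (Γ × Bool) → List (Λ × Bool)
  primrec_incl : Primrec incl
  eval_incl : ∀ l, e (FreeGroup.mk (incl l)) = θ (k (FreeGroup.mk l))
  primrecPred_eq_one : PrimrecPred fun l : List (Γ × Bool) => k (FreeGroup.mk l) = 1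
  /-- Bounds the length of generators of `conjPullback`. -/
  growth : ℕ → ℕ → ℕ
  primrec_growth : Primrec₂ growth
  generatedByShort_conjPullback : ∀ {N D}, GeneratedByShort k N D → ∀ w : List (Λ × Bool),
    GeneratedByShort k (growth N w.length) (conjPullback θ (e (FreeGroup.mk w)) D)
  /-- Bounds the length of elements outside the range of `θ` conjugating into it. -/
  radius : ℕ
  exists_short_conj : ∀ l : List (Γ × Bool), k (FreeGroup.mk l) ≠ 1 → ∀ a ∉ θ.range,
    a * θ (k (FreeGroup.mk l)) * a⁻¹ ∈ θ.range →
    ∃ w : List (Λ × Bool), w.length ≤ radius * (l.length + 1) ∧ e (FreeGroup.mk w) ∉ θ.range ∧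
      e (FreeGroup.mk w) * θ (k (FreeGroup.mk l)) * (e (FreeGroup.mk w))⁻¹ ∈ θ.range

namespace FreeGroup

theorem Quasiconvex.inf_listsUpTo {α : Type*} [DecidableEq α] [Fintype α]
    {H K : Subgroup (FreeGroup α)} {R S : ℕ} (hH : Quasiconvex H R) (hK : Quasiconvex K S) :
    Quasiconvex (H ⊓ K)
      ((listsUpTo (α × Bool) R).length * (listsUpTo (α × Bool) S).length) := by
  have key : ∀ (R : ℕ) (t : FreeGroup α), t.norm ≤ R →
      t ∈ ((listsUpTo (α × Bool) R).map mk).toFinset := by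
    intro R t ht
    rw [List.mem_toFinset, List.mem_map]
    exact ⟨t.toWord, mem_listsUpTo ht, mk_toWord⟩
  refine (hH.inf hK (key R) (key S)).mono (Nat.mul_le_mul ?_ ?_) <;>
  exact (List.toFinset_card_le _).trans (by simp)

/-- The image of the pullback under `θ` is the intersection of `g θ(D) g⁻¹` with the range of `θ`.
Both are quasiconvex with known constants, so the effective Howson theorem yields short generators,
which the transducer turns back into words for `C`. -/
theorem exists_generatedByShort_conjPullback {α Γ : Type*} [DecidableEq α] [Fintype α] [Primcodable α]
    [Primcodable Γ] [Finite Γ] {C : Type*} [Group C] (k : FreeGroup Γ →* C)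
    (hk : Function.Surjective k) (θ : C →* FreeGroup α) (hθ : Function.Injective θ) :
    ∃ F : ℕ → ℕ → ℕ, Primrec₂ F ∧ ∀ N D, GeneratedByShort k N D → ∀ (g : FreeGroup α) (n : ℕ),
      g.norm ≤ n → GeneratedByShort k (F N n) (conjPullback θ g D) := by
  let f := θ.comp k
  have hf : f.range = θ.range := by
    rw [MonoidHom.range_comp, MonoidHom.range_eq_top.2 hk, ← MonoidHom.range_eq_map]
  obtain ⟨R, hR⟩ := exists_quasiconvex_range f
  obtain ⟨K, hK⟩ := exists_norm_map_le f
  obtain ⟨ρ, -, hρ, hρ', M, hM⟩ := exists_transducer f hR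
  -- Conjugated generators have norm at most `K * N + 2 * n`; numbers of words bound the sizes of
  -- balls. Generators of the intersection have norm at most twice the product plus one, and the
  -- transducer estimate `M * (length + 1)` accounts for the final `+ 2`.
  refine ⟨fun N n => M * (2 * ((listsUpTo (α × Bool) (K * N + 2 * n)).length *
    (listsUpTo (α × Bool) R).length) + 2), ?_, ?_⟩
  · refine Primrec.nat_mul.comp (Primrec.const M) (Primrec.nat_add.comp (Primrec.nat_mul.comp
      (Primrec.const 2) (Primrec.nat_mul.comp ?_ (Primrec.const _))) (Primrec.const 2))
    refine Primrec.list_length.comp ((Primrec.listsUpTo _).comp (Primrec.nat_add.comp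
      (Primrec.nat_mul.comp (Primrec.const K) Primrec.fst)
      (Primrec.nat_mul.comp (Primrec.const 2) Primrec.snd)))
  · intro N D hD g n hg
    set S := {c | c ∈ D ∧ ∃ l : List (Γ × Bool), l.length ≤ N ∧ k (FreeGroup.mk l) = c} with hS
    have hDS : D = Subgroup.closure S :=
      le_antisymm hD ((Subgroup.closure_le _).2 fun c hc => hc.1)
    set J₁ := (D.map θ).map (MulAut.conj g).toMonoidHom with hJ₁
    have q₁ : Quasiconvex J₁ (K * N + 2 * n) := by
      rw [hJ₁, hDS, MonoidHom.map_closure, MonoidHom.map_closure]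
      refine Quasiconvex.of_closure ?_
      rintro _ ⟨_, ⟨_, ⟨_, l, hl, rfl⟩, rfl⟩, rfl⟩
      have h₁ := hK l
      have h₂ := norm_mul_le (g * θ (k (mk l))) g⁻¹
      have h₃ := norm_mul_le g (θ (k (mk l)))
      have h₄ := Nat.mul_le_mul_left K hl
      rw [norm_inv_eq] at h₂
      simp only [f, MonoidHom.comp_apply] at h₁
      simp only [MulEquiv.coe_toMonoidHom, MulAut.conj_apply]
      omega
    have q := q₁.inf_listsUpTo hR
    intro c hc
    have hcJ : θ c ∈ J₁ ⊓ f.range := ⟨hc, hf ▸ ⟨c, rfl⟩⟩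
    rw [q.closure_eq] at hcJ
    have hle : Subgroup.closure {h | h ∈ J₁ ⊓ f.range ∧ h.norm ≤ 2 *
        ((listsUpTo (α × Bool) (K * N + 2 * n)).length * (listsUpTo (α × Bool) R).length) + 1} ≤
        (Subgroup.closure {c | c ∈ conjPullback θ g D ∧ ∃ l : List (Γ × Bool), l.length ≤
          M * (2 * ((listsUpTo (α × Bool) (K * N + 2 * n)).length *
          (listsUpTo (α × Bool) R).length) + 2) ∧ k (mk l) = c}).map θ := by
      rw [Subgroup.closure_le]
      rintro h ⟨⟨h₁, h₂⟩, h₃⟩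
      obtain ⟨l, hl⟩ := hρ' h h₂
      have hl₁ := hρ _ _ hl
      rw [mk_toWord] at hl₁
      have hl₂ := hM _ _ hl
      refine ⟨k (mk l), Subgroup.subset_closure ⟨?_, l, hl₂.trans (Nat.mul_le_mul_left M ?_), rfl⟩, hl₁⟩
      · change θ (k (mk l)) ∈ J₁
        exact hl₁ ▸ h₁
      · rw [norm_eq_length] at h₃
        omega
    obtain ⟨d, hd, hdc⟩ := hle hcJ
    rw [← hθ hdc]
    exact hd

end FreeGroup

open FreeGroup in
theorem exists_factorAlgorithm {Λ Γ : Type} [Primcodable Λ] [Primcodable Γ] [Finite Λ] [Finite Γ]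
    {H C : Type*} [Group H] [IsFreeGroup H] [Group C] (e : FreeGroup Λ →* H)
    (he : Function.Surjective e) (k : FreeGroup Γ →* C) (hk : Function.Surjective k) (θ : C →* H)
    (hθ : Function.Injective θ) : Nonempty (FactorAlgorithm e k θ) := by
  classical
  obtain ⟨r, ⟨κ⟩⟩ := IsFreeGroup.exists_mulEquiv_fin e he
  let E : FreeGroup Λ →* FreeGroup (Fin r) := κ.toMonoidHom.comp e
  have hE : Function.Surjective E := κ.surjective.comp he
  let Θ : C →* FreeGroup (Fin r) := κ.toMonoidHom.comp θ
  have hΘ : Function.Injective Θ := κ.injective.comp hθ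
  let f := Θ.comp k
  have hf : f.range = Θ.range := by
    rw [MonoidHom.range_comp, MonoidHom.range_eq_top.2 hk, ← MonoidHom.range_eq_map]
  have hrange : ∀ a, κ a ∈ Θ.range ↔ a ∈ θ.range := by
    intro a
    simp only [MonoidHom.mem_range, Θ, MonoidHom.comp_apply, MulEquiv.coe_toMonoidHom,
      EmbeddingLike.apply_eq_iff_eq]
  obtain ⟨R, hR⟩ := exists_quasiconvex_range f
  obtain ⟨K, hK⟩ := exists_norm_map_le f
  obtain ⟨K₂, hK₂⟩ := exists_norm_map_le E
  obtain ⟨ρ, pρ, hρ, hρ', -⟩ := exists_transducer f hR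
  obtain ⟨F, pF, hF⟩ := exists_generatedByShort_conjPullback k hk Θ hΘ
  obtain ⟨j, hj⟩ := exists_section e he (θ.comp k)
  obtain ⟨s, hs⟩ := exists_section E hE (MonoidHom.id _)
  -- The section `s` turns elements of the free group on `Fin r` back into words over `Λ`. A
  -- conjugator of norm at most `R + K * l.length` thus becomes a word at most `K₃` times as long,
  -- which explains the radius `K₃ * (R + K)`.
  obtain ⟨K₃, hK₃⟩ := exists_length_substWord_le s
  have normal : ∀ w, reduce (substWord E w) = (E (mk w)).toWord := fun w => by
    rw [← toWord_mk, mk_substWord]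
  refine ⟨⟨fun w => ρ (reduce (substWord E w)),
    pρ.comp (primrec_reduce.comp (primrec_substWord E)), ?_, ?_, substWord j, primrec_substWord j,
    ?_, ?_, fun N n => F N (K₂ * n), ?_, ?_, K₃ * (R + K), ?_⟩⟩
  · intro w l h
    have := hρ _ _ h
    rw [normal, mk_toWord] at this
    exact κ.injective this.symm
  · intro w h hm
    rw [normal] at h
    obtain ⟨l, hl⟩ := hρ' (E (mk w)) (by rw [hf]; exact (hrange _).2 hm)
    rw [h] at hl
    cases hl
  · intro l
    rw [mk_substWord, hj, MonoidHom.comp_apply]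
  · refine (Primrec.eq.comp (primrec_reduce.comp (primrec_substWord f)) (Primrec.const [])).of_eq ?_
    intro l
    rw [← toWord_mk, mk_substWord, toWord_eq_nil_iff]
    exact map_eq_one_iff Θ hΘ
  · exact pF.comp Primrec.fst (Primrec.nat_mul.comp (Primrec.const K₂) Primrec.snd)
  · intro N D hD w
    have := hF N D hD (E (mk w)) (K₂ * w.length) (hK₂ w)
    convert this using 1
    ext c
    simp only [mem_conjPullback]
    refine exists_congr fun d => and_congr_right fun _ => ?_
    rw [← κ.injective.eq_iff]
    simp [E, Θ]
  · intro l hl a ha hm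
    obtain ⟨a', h₁, h₂⟩ := hR.exists_norm_le_of_conj_mem (u := f (mk l))
      (fun h => hl ((map_eq_one_iff Θ hΘ).1 h)) (κ a) (by
        rw [hf]
        have := (hrange _).2 hm
        simpa [f, Θ] using this)
    rw [hf] at h₂
    have hw : κ (e (mk (substWord s a'.toWord))) = a' := by
      rw [mk_substWord, mk_toWord]; exact hs a'
    set b := e (mk (substWord s a'.toWord)) with hb
    have h₃ : a * b⁻¹ ∈ θ.range := by
      rw [← hrange, _root_.map_mul, _root_.map_inv, hw]; exact h₂
    refine ⟨substWord s a'.toWord, ?_, ?_, ?_⟩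
    · have k₁ := hK₃ a'.toWord
      have k₂ := hK l
      rw [← norm_eq_length] at k₁
      calc _ ≤ K₃ * (R + K * l.length) := k₁.trans (Nat.mul_le_mul_left _ (by omega))
        _ ≤ K₃ * (R + K) * (l.length + 1) := by
          rw [mul_assoc]
          refine Nat.mul_le_mul_left _ ?_
          nlinarith [Nat.zero_le (R * l.length)]
    · rw [← hb]
      intro hbm
      exact ha (by simpa using mul_mem h₃ hbm)
    · rw [← hb]
      have := mul_mem (mul_mem (inv_mem h₃) hm) h₃
      convert this using 1
      group

/-! ### Reduced forms and singular elements in an amalgamated product. -/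

section

open Monoid.PushoutI

namespace Amalgam

section Reduced

variable {ι : Type*} {H : ι → Type*} [∀ i, Group (H i)] {C : Type*} [Group C]
  (θ : ∀ i, C →* H i)

/-- A sequence of syllables outside the amalgamated subgroup, neighbours from different factors. -/
def IsReducedList (s : List (Σ i, H i)) : Prop :=
  s.IsChain (fun x y => x.1 ≠ y.1) ∧ ∀ x ∈ s, x.2 ∉ (θ x.1).range

/-- The element of the amalgamated product represented by a sequence of syllables. -/
def listProd (s : List (Σ i, H i)) : Monoid.PushoutI θ :=
  (s.map fun x => of (φ := θ) x.1 x.2).prod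

@[simp] theorem listProd_nil : listProd θ [] = 1 := rfl

@[simp] theorem listProd_cons (x : Σ i, H i) (s : List (Σ i, H i)) :
    listProd θ (x :: s) = of (φ := θ) x.1 x.2 * listProd θ s := by simp [listProd]

@[simp] theorem listProd_append (s t : List (Σ i, H i)) :
    listProd θ (s ++ t) = listProd θ s * listProd θ t := by simp [listProd]

variable {θ}

theorem isReducedList_nil : IsReducedList θ [] := ⟨by simp, by simp⟩

theorem isReducedList_cons {x : Σ i, H i} {s : List (Σ i, H i)} :
    IsReducedList θ (x :: s) ↔
      x.2 ∉ (θ x.1).range ∧ (∀ y ∈ s.head?, x.1 ≠ y.1) ∧ IsReducedList θ s := by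
  simp only [IsReducedList, List.isChain_cons, List.forall_mem_cons]
  tauto

theorem of_mem_base_range_of_mem_range {i : ι} {a : H i} (h : a ∈ (θ i).range) :
    of (φ := θ) i a ∈ (base θ).range := by
  obtain ⟨c, rfl⟩ := h
  exact ⟨c, (of_apply_eq_base θ i c).symm⟩

theorem IsReducedList.eq_nil_of_mem_range (hθ : ∀ i, Function.Injective (θ i))
    {s : List (Σ i, H i)} (hs : IsReducedList θ s) (h : listProd θ s ∈ (base θ).range) :
    s = [] := by
  let w : Monoid.CoprodI.Word H := ⟨s, fun x hx h1 => hs.2 x hx (h1 ▸ one_mem _), hs.1⟩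
  have hw : Reduced θ w := hs.2
  have hp : ofCoprodI (φ := θ) w.prod = listProd θ s := by
    simp [w, Monoid.CoprodI.Word.prod, listProd, map_list_prod, Function.comp_def]
  have := hw.eq_empty_of_mem_range hθ (hp ▸ h)
  exact congrArg Monoid.CoprodI.Word.toList this

theorem mem_range_of_of_mem_base_range (hθ : ∀ i, Function.Injective (θ i)) {i : ι} {a : H i}
    (h : of (φ := θ) i a ∈ (base θ).range) : a ∈ (θ i).range := by
  by_contra ha
  have hr : IsReducedList θ [⟨i, a⟩] := ⟨by simp, by simpa using ha⟩
  have := hr.eq_nil_of_mem_range hθ (by simpa using h)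
  simp at this

/-- The formal inverse of a sequence of syllables. -/
def invList (s : List (Σ i, H i)) : List (Σ i, H i) :=
  (s.map fun x => (⟨x.1, x.2⁻¹⟩ : Σ i, H i)).reverse

theorem listProd_invList (s : List (Σ i, H i)) :
    listProd θ (invList s) = (listProd θ s)⁻¹ := by
  induction s with
  | nil => simp [invList]
  | cons x s ih =>
    simp only [invList, List.map_cons, List.reverse_cons, listProd_append, listProd_cons,
      listProd_nil, mul_one, mul_inv_rev, map_inv] at ih ⊢
    rw [ih]

theorem IsReducedList.invList {s : List (Σ i, H i)} (hs : IsReducedList θ s) :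
    IsReducedList θ (invList s) := by
  refine ⟨?_, ?_⟩
  · rw [Amalgam.invList, List.isChain_reverse, List.isChain_map]
    exact hs.1.imp fun _ _ h => h.symm
  · intro x hx
    simp only [Amalgam.invList, List.mem_reverse, List.mem_map] at hx
    obtain ⟨y, hy, rfl⟩ := hx
    simpa using hs.2 y hy

/-- If the first syllable moved `c` out of the amalgamated subgroup, then the inverse of `s`, the
syllable `x⁻¹ c x` and `s` would together form a nonempty reduced sequence, whose product cannot lie
in that subgroup. -/
theorem IsReducedList.conj_mem_range (hθ : ∀ i, Function.Injective (θ i)) {x : Σ i, H i}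
    {s : List (Σ i, H i)} (hs : IsReducedList θ (x :: s)) {c : C}
    (h : (listProd θ (x :: s))⁻¹ * base θ c * listProd θ (x :: s) ∈ (base θ).range) :
    x.2⁻¹ * θ x.1 c * x.2 ∈ (θ x.1).range := by
  by_contra hc
  obtain ⟨-, hx, hs'⟩ := isReducedList_cons.1 hs
  have hmid : IsReducedList θ ((⟨x.1, x.2⁻¹ * θ x.1 c * x.2⟩ : Σ i, H i) :: s) :=
    isReducedList_cons.2 ⟨hc, hx, hs'⟩
  have hr : IsReducedList θ (Amalgam.invList s ++
      ((⟨x.1, x.2⁻¹ * θ x.1 c * x.2⟩ : Σ i, H i) :: s)) := by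
    refine ⟨List.isChain_append.2 ⟨hs'.invList.1, hmid.1, ?_⟩, ?_⟩
    · intro a ha b hb
      simp only [List.head?_cons, Option.mem_def, Option.some.injEq] at hb
      subst hb
      simp only [Amalgam.invList, List.getLast?_reverse, List.head?_map, Option.mem_def,
        Option.map_eq_some_iff] at ha
      obtain ⟨y, hy, rfl⟩ := ha
      exact (hx y hy).symm
    · intro y hy
      rw [List.mem_append] at hy
      exact hy.elim (hs'.invList.2 y) (hmid.2 y)
  have := hr.eq_nil_of_mem_range hθ (by
    convert h using 1
    simp only [listProd_append, listProd_cons, listProd_invList, map_mul, map_inv, mul_inv_rev,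
      of_apply_eq_base]
    group)
  simp at this

theorem mem_generalizedNormalizer_iff {G : Type*} [Group G] {K : Subgroup G} {g : G} :
    g ∈ generalizedNormalizer K ↔ ∃ x ∈ K, x ≠ 1 ∧ g⁻¹ * x * g ∈ K := by
  simp only [generalizedNormalizer, Set.mem_ofPred_eq, ne_eq, Subgroup.eq_bot_iff_forall,
    not_forall, Subgroup.mem_inf, Subgroup.mem_map, MulEquiv.coe_toMonoidHom, MulAut.conj_apply]
  constructor
  · rintro ⟨_, ⟨h₁, y, hy, rfl⟩, h₂⟩
    refine ⟨_, h₁, h₂, ?_⟩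
    convert hy using 1; group
  · rintro ⟨x, h₁, h₂, h₃⟩
    exact ⟨x, ⟨h₁, _, h₃, by group⟩, h₂⟩

theorem mem_blackHole_of_notMem {G : Type*} [Group G] {K : Subgroup G} {g : G} (hg : g ∉ K) :
    g ∈ blackHole K ↔ ∃ x ∈ K, x ≠ 1 ∧ g⁻¹ * x * g ∈ K := by
  rw [← mem_generalizedNormalizer_iff]
  simp only [blackHole, conjStayUnion, conjStaySet, Set.mem_union, Set.mem_sdiff, Set.mem_iUnion,
    SetLike.mem_coe, Set.mem_ofPred_eq]
  tauto

/-- The requirement that the conjugator be in the generalized normalizer is automatic: the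
nontrivial `x` itself witnesses it. -/
theorem mem_blackHole_of_mem {G : Type*} [Group G] {K : Subgroup G} {x : G} (hx : x ∈ K)
    (hx1 : x ≠ 1) : x ∈ blackHole K ↔ ∃ g, g ∉ K ∧ g⁻¹ * x * g ∈ K := by
  simp only [blackHole, conjStayUnion, conjStaySet, Set.mem_union, Set.mem_sdiff, Set.mem_iUnion,
    SetLike.mem_coe, Set.mem_ofPred_eq, hx, not_true_eq_false, and_false, false_or, true_and,
    exists_prop]
  constructor
  · rintro ⟨g, ⟨-, h₁⟩, h₂⟩
    exact ⟨g⁻¹, by simpa using h₁, by simpa using h₂⟩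
  · rintro ⟨g, h₁, h₂⟩
    refine ⟨g⁻¹, ⟨mem_generalizedNormalizer_iff.2 ⟨_, h₂, ?_, ?_⟩, by simpa using h₁⟩,
      by simpa using h₂⟩
    · intro h
      rw [mul_assoc, inv_mul_eq_one] at h
      exact hx1 (by simpa using h)
    · convert hx using 1; group

/-- If every element has a reduced form, a nontrivial element of the amalgamated subgroup is
singular if and only if it is conjugated into that subgroup by an element of a factor. -/
theorem base_mem_blackHole_iff (hθ : ∀ i, Function.Injective (θ i))
    (hform : ∀ g : Monoid.PushoutI θ, ∃ s c, IsReducedList θ s ∧ g = listProd θ s * base θ c)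
    {c : C} (hc : c ≠ 1) :
    base θ c ∈ blackHole (base θ).range ↔
      ∃ i, ∃ a ∉ (θ i).range, a * θ i c * a⁻¹ ∈ (θ i).range := by
  rw [mem_blackHole_of_mem (⟨c, rfl⟩ : base θ c ∈ (base θ).range)
    (fun h => hc ((map_eq_one_iff _ (base_injective hθ)).1 h))]
  constructor
  · rintro ⟨g, hg, hm⟩
    obtain ⟨s, d, hs, rfl⟩ := hform g
    -- The trailing factor `base θ d` normalizes the amalgamated subgroup and can be dropped; the
    -- first syllable alone then gives the conjugator.
    have hm' : (listProd θ s)⁻¹ * base θ c * listProd θ s ∈ (base θ).range := by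
      have := mul_mem (mul_mem (⟨d, rfl⟩ : base θ d ∈ (base θ).range) hm)
        (⟨d⁻¹, rfl⟩ : base θ d⁻¹ ∈ (base θ).range)
      convert this using 1
      rw [map_inv]; group
    cases s with
    | nil => exact absurd ⟨d, by simp⟩ hg
    | cons x s =>
      refine ⟨x.1, x.2⁻¹, ?_, ?_⟩
      · simpa using (isReducedList_cons.1 hs).1
      · simpa using hs.conj_mem_range hθ hm'
  · rintro ⟨i, a, ha, hm⟩
    refine ⟨of i a⁻¹, fun h => ha ?_, ?_⟩
    · simpa using mem_range_of_of_mem_base_range hθ h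
    · have := of_mem_base_range_of_mem_range hm
      simpa [of_apply_eq_base] using this

end Reduced

end Amalgam

end

/-! ### Normal forms and finite searches in the amalgamated product. -/

section

open Monoid.PushoutI FreeGroup

theorem Primrec.bool_dispatch {α σ : Type*} [Primcodable α] [Primcodable σ] {f : Bool → α → σ}
    (hf : ∀ b, Primrec (f b)) : Primrec₂ f := by
  refine (Primrec.cond Primrec.fst ((hf true).comp Primrec.snd)
    ((hf false).comp Primrec.snd)).of_eq fun p => ?_
  rcases p with ⟨_ | _, a⟩ <;> rfl

/-- This reduces nontriviality to a finite search: if all short elements were trivial, so would be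
the subgroup they generate. -/
theorem GeneratedByShort.ne_bot_iff {Γ : Type*} [Fintype Γ] {C : Type*} [Group C]
    {k : FreeGroup Γ →* C} {N : ℕ} {D : Subgroup C} (h : GeneratedByShort k N D) :
    D ≠ ⊥ ↔ ∃ l ∈ listsUpTo (Γ × Bool) N, k (mk l) ≠ 1 ∧ k (mk l) ∈ D := by
  constructor
  · intro hD
    by_contra! hc
    refine hD (eq_bot_iff.2 (h.trans ((Subgroup.closure_le _).2 ?_)))
    rintro _ ⟨hm, l, hl, rfl⟩
    by_contra h1
    exact hc l (mem_listsUpTo hl) h1 hm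
  · rintro ⟨l, -, h1, hm⟩ rfl
    exact h1 hm

theorem generatedByShort_top {Γ : Type*} {C : Type*} [Group C] {k : FreeGroup Γ →* C}
    (hk : Function.Surjective k) : GeneratedByShort k 1 ⊤ := by
  have : (⊤ : Subgroup C) = Subgroup.closure (k '' Set.range of) := by
    rw [← MonoidHom.map_closure, closure_range_of, ← MonoidHom.range_eq_map,
      MonoidHom.range_eq_top.2 hk]
  refine this.le.trans (Subgroup.closure_mono ?_)
  rintro _ ⟨_, ⟨x, rfl⟩, rfl⟩
  exact ⟨trivial, [(x, true)], by simp, rfl⟩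

namespace Amalgam

section States

variable {Λ Γ : Type} {H : Bool → Type u} [∀ b, Group (H b)]
  {C : Type v} [Group C] {e : ∀ b, FreeGroup Λ →* H b} {θ : ∀ b, C →* H b}

/-- The syllable represented by a word in the letters of a factor. -/
def toSyllable (e : ∀ b, FreeGroup Λ →* H b) (y : Bool × List (Λ × Bool)) : Σ b, H b :=
  ⟨y.1, e y.1 (mk y.2)⟩

/-- The element represented by a list of syllable words followed by a word for an element of `C`. -/
def evalState (e : ∀ b, FreeGroup Λ →* H b) (k : FreeGroup Γ →* C) (θ : ∀ b, C →* H b)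
    (T : List (Bool × List (Λ × Bool)) × List (Γ × Bool)) : Monoid.PushoutI θ :=
  listProd θ (T.1.map (toSyllable e)) * base θ (k (mk T.2))

/-- Multiply the word `v` of the factor `b` with the first syllable, if that is of the factor `b`. -/
def absorb (b : Bool) (v : List (Λ × Bool)) (σ : List (Bool × List (Λ × Bool))) :
    List (Λ × Bool) × List (Bool × List (Λ × Bool)) :=
  List.casesOn σ (v, []) fun y t => if y.1 = b then (v ++ y.2, t) else (v, y :: t)

/-- The elements of `C` that the successive syllables of `σ` conjugate into `C`. -/
def stabilizer (e : ∀ b, FreeGroup Λ →* H b) (θ : ∀ b, C →* H b)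
    (σ : List (Bool × List (Λ × Bool))) : Subgroup C :=
  σ.foldr (fun y D => conjPullback (θ y.1) (e y.1 (mk y.2)) D) ⊤

theorem absorb_spec (b : Bool) (v : List (Λ × Bool)) {σ : List (Bool × List (Λ × Bool))}
    (hσ : IsReducedList θ (σ.map (toSyllable e))) :
    IsReducedList θ ((absorb b v σ).2.map (toSyllable e)) ∧
    (∀ y ∈ ((absorb b v σ).2.map (toSyllable e)).head?, b ≠ y.1) ∧
    of (φ := θ) b (e b (mk (absorb b v σ).1)) * listProd θ ((absorb b v σ).2.map (toSyllable e)) =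
      of (φ := θ) b (e b (mk v)) * listProd θ (σ.map (toSyllable e)) := by
  rcases σ with _ | ⟨y, t⟩
  · exact ⟨isReducedList_nil, by simp [absorb], by simp [absorb]⟩
  · by_cases h : y.1 = b
    · subst h
      simp only [List.map_cons, isReducedList_cons] at hσ
      simp only [absorb, if_true]
      refine ⟨hσ.2.2, hσ.2.1, ?_⟩
      simp only [List.map_cons, listProd_cons, toSyllable, ← mul_mk, _root_.map_mul, mul_assoc]
    · simp only [absorb, if_neg h]
      refine ⟨hσ, ?_, trivial⟩
      simp only [List.map_cons, List.head?_cons, Option.mem_def, Option.some.injEq]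
      rintro _ rfl
      exact Ne.symm h

/-- Peel off the first syllable: by `IsReducedList.conj_mem_range` it must already carry `c` to some
`d` in `C`, and the remaining syllables act on `d`. -/
theorem mem_stabilizer_iff (hθ : ∀ b, Function.Injective (θ b))
    {σ : List (Bool × List (Λ × Bool))} (hσ : IsReducedList θ (σ.map (toSyllable e))) {c : C} :
    c ∈ stabilizer e θ σ ↔ (listProd θ (σ.map (toSyllable e)))⁻¹ * base θ c *
      listProd θ (σ.map (toSyllable e)) ∈ (base θ).range := by
  induction σ generalizing c with
  | nil => exact ⟨fun _ => ⟨c, by simp⟩, fun _ => trivial⟩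
  | cons y t ih =>
    have h₂ : stabilizer e θ (y :: t) =
      conjPullback (θ y.1) (e y.1 (mk y.2)) (stabilizer e θ t) := rfl
    have ht := (isReducedList_cons.1 hσ).2.2
    have key : ∀ d, (e y.1 (mk y.2))⁻¹ * θ y.1 c * e y.1 (mk y.2) = θ y.1 d →
        (listProd θ ((y :: t).map (toSyllable e)))⁻¹ * base θ c *
          listProd θ ((y :: t).map (toSyllable e)) =
        (listProd θ (t.map (toSyllable e)))⁻¹ * base θ d * listProd θ (t.map (toSyllable e)) := by
      intro d hd
      have := congrArg (of (φ := θ) y.1) hd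
      simp only [_root_.map_mul, _root_.map_inv, of_apply_eq_base] at this
      rw [← this, List.map_cons, listProd_cons]
      simp only [toSyllable, mul_inv_rev, mul_assoc]
      rfl
    rw [h₂, mem_conjPullback]
    constructor
    · rintro ⟨d, hd, h⟩
      rw [key d h]
      exact (ih ht).1 hd
    · intro h
      obtain ⟨d, hd⟩ := IsReducedList.conj_mem_range hθ hσ h
      refine ⟨d, (ih ht).2 ?_, hd.symm⟩
      rw [← key d hd.symm]
      exact h

end States

section Algorithm

variable {Λ Γ : Type} [Primcodable Λ] [Primcodable Γ] {H : Bool → Type u} [∀ b, Group (H b)]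
  {C : Type v} [Group C] {e : ∀ b, FreeGroup Λ →* H b} {k : FreeGroup Γ →* C}
  {θ : ∀ b, C →* H b}

variable (alg : ∀ b, FactorAlgorithm (e b) k (θ b))

/-- Left multiplication of a state by an element of the amalgamated subgroup. -/
def mulBase (l : List (Γ × Bool)) (T : List (Bool × List (Λ × Bool)) × List (Γ × Bool)) :
    List (Bool × List (Λ × Bool)) × List (Γ × Bool) :=
  List.casesOn T.1 ([], l ++ T.2) fun y t => ((y.1, (alg y.1).incl l ++ y.2) :: t, T.2)

/-- Left multiplication of a state by an element of the factor `b`. -/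
def push (b : Bool) (v : List (Λ × Bool)) (T : List (Bool × List (Λ × Bool)) × List (Γ × Bool)) :
    List (Bool × List (Λ × Bool)) × List (Γ × Bool) :=
  Option.casesOn ((alg b).rewrite (absorb b v T.1).1)
    ((b, (absorb b v T.1).1) :: (absorb b v T.1).2, T.2)
    fun l => mulBase alg l ((absorb b v T.1).2, T.2)

/-- The reduced form of a word, where the letter `x` belongs to the factor `side x`. -/
def normalForm (side : Λ → Bool) (w : List (Λ × Bool)) :
    List (Bool × List (Λ × Bool)) × List (Γ × Bool) :=
  w.foldr (fun x T => push alg (side x.1) [x] T) ([], [])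

/-- Conjugate an element of the amalgamated subgroup by the inverses of the successive syllables,
as long as the result stays in the amalgamated subgroup. -/
def conjChain (σ : List (Bool × List (Λ × Bool))) (o : Option (List (Γ × Bool))) :
    Option (List (Γ × Bool)) :=
  σ.foldl (fun o y => o.bind fun l =>
    (alg y.1).rewrite (invRev y.2 ++ ((alg y.1).incl l ++ y.2))) o

/-- The length of words needed to generate `stabilizer`. -/
def stabilizerBound (σ : List (Bool × List (Λ × Bool))) : ℕ :=
  σ.foldr (fun y N => (alg y.1).growth N y.2.length) 1

variable {alg}

theorem evalState_mulBase (l : List (Γ × Bool))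
    (T : List (Bool × List (Λ × Bool)) × List (Γ × Bool)) :
    evalState e k θ (mulBase alg l T) = base θ (k (mk l)) * evalState e k θ T := by
  rcases T with ⟨_ | ⟨y, t⟩, c⟩
  · simp [mulBase, evalState, ← mul_mk, _root_.map_mul]
  · simp only [mulBase, evalState, List.map_cons, listProd_cons, toSyllable, ← mul_mk,
      _root_.map_mul, (alg y.1).eval_incl, of_apply_eq_base, mul_assoc]

theorem isReducedList_mulBase (l : List (Γ × Bool))
    {T : List (Bool × List (Λ × Bool)) × List (Γ × Bool)}
    (hT : IsReducedList θ (T.1.map (toSyllable e))) :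
    IsReducedList θ ((mulBase alg l T).1.map (toSyllable e)) := by
  rcases T with ⟨_ | ⟨y, t⟩, c⟩
  · exact isReducedList_nil
  · simp only [mulBase, List.map_cons, isReducedList_cons] at hT ⊢
    refine ⟨fun h => hT.1 ?_, hT.2⟩
    simp only [toSyllable, ← mul_mk, _root_.map_mul, (alg y.1).eval_incl] at h ⊢
    exact ((θ y.1).range.mul_mem_cancel_left ⟨_, rfl⟩).1 h

theorem evalState_push (b : Bool) (v : List (Λ × Bool))
    {T : List (Bool × List (Λ × Bool)) × List (Γ × Bool)}
    (hT : IsReducedList θ (T.1.map (toSyllable e))) :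
    evalState e k θ (push alg b v T) = of (φ := θ) b (e b (mk v)) * evalState e k θ T := by
  obtain ⟨-, -, h⟩ := absorb_spec b v hT
  rw [evalState.eq_1 e k θ T, ← mul_assoc, ← h]
  unfold push
  cases hr : (alg b).rewrite (absorb b v T.1).1 with
  | none => simp only [evalState, List.map_cons, listProd_cons, toSyllable]
  | some l =>
    rw [(alg b).eval_of_rewrite_eq_some hr, of_apply_eq_base]
    simp only [evalState_mulBase]
    simp only [evalState, mul_assoc]

theorem isReducedList_push (b : Bool) (v : List (Λ × Bool))
    {T : List (Bool × List (Λ × Bool)) × List (Γ × Bool)}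
    (hT : IsReducedList θ (T.1.map (toSyllable e))) :
    IsReducedList θ ((push alg b v T).1.map (toSyllable e)) := by
  obtain ⟨h₁, h₂, -⟩ := absorb_spec b v hT
  unfold push
  cases hr : (alg b).rewrite (absorb b v T.1).1 with
  | none =>
    simp only [List.map_cons, isReducedList_cons]
    exact ⟨(alg b).notMem_of_rewrite_eq_none hr, h₂, h₁⟩
  | some l => exact isReducedList_mulBase l h₁

theorem isReducedList_normalForm (side : Λ → Bool) (w : List (Λ × Bool)) :
    IsReducedList θ ((normalForm alg side w).1.map (toSyllable e)) := by
  induction w with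
  | nil => exact isReducedList_nil
  | cons x w ih => exact isReducedList_push _ _ ih

theorem evalState_normalForm (side : Λ → Bool) (w : List (Λ × Bool)) :
    evalState e k θ (normalForm alg side w) =
      (w.map fun x => of (φ := θ) (side x.1) (e (side x.1) (mk [x]))).prod := by
  induction w with
  | nil => simp [normalForm, evalState, ← one_eq_mk]
  | cons x w ih =>
    rw [List.map_cons, List.prod_cons, ← ih]
    exact evalState_push _ _ (isReducedList_normalForm side w)

theorem exists_reduced_form (alg : ∀ b, FactorAlgorithm (e b) k (θ b))
    (he : ∀ b, Function.Surjective (e b)) (hk : Function.Surjective k)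
    (g : Monoid.PushoutI θ) : ∃ s c, IsReducedList θ s ∧ g = listProd θ s * base θ c := by
  -- Generalized to left multiplication of an arbitrary reduced state by `g`, so that products
  -- follow by composition.
  suffices h : ∀ T : List (Bool × List (Λ × Bool)) × List (Γ × Bool),
      IsReducedList θ (T.1.map (toSyllable e)) → ∃ T' : List (Bool × List (Λ × Bool)) ×
      List (Γ × Bool), IsReducedList θ (T'.1.map (toSyllable e)) ∧
      evalState e k θ T' = g * evalState e k θ T by
    obtain ⟨T, h₁, h₂⟩ := h ([], []) isReducedList_nil
    refine ⟨_, k (mk T.2), h₁, ?_⟩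
    simp only [evalState, List.map_nil, listProd_nil, ← one_eq_mk, _root_.map_one, mul_one] at h₂
    exact h₂.symm
  induction g using Monoid.PushoutI.induction_on with
  | of b a =>
    intro T hT
    obtain ⟨v, rfl⟩ := he b a
    obtain ⟨v, rfl⟩ := Quot.exists_rep v
    exact ⟨push alg b v T, isReducedList_push _ _ hT, evalState_push _ _ hT⟩
  | base c =>
    intro T hT
    obtain ⟨l, rfl⟩ := hk c
    obtain ⟨l, rfl⟩ := Quot.exists_rep l
    exact ⟨mulBase alg l T, isReducedList_mulBase _ hT, evalState_mulBase _ _⟩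
  | mul g g' ih ih' =>
    intro T hT
    obtain ⟨T', h₁, h₂⟩ := ih' T hT
    obtain ⟨T'', h₃, h₄⟩ := ih T' h₁
    exact ⟨T'', h₃, by rw [h₄, h₂, mul_assoc]⟩

theorem conjChain_none (σ : List (Bool × List (Λ × Bool))) : conjChain alg σ none = none := by
  induction σ with
  | nil => rfl
  | cons y t ih => exact ih

theorem conjChain_isSome_iff (hθ : ∀ b, Function.Injective (θ b))
    (σ : List (Bool × List (Λ × Bool))) (l : List (Γ × Bool)) :
    (conjChain alg σ (some l)).isSome ↔ k (mk l) ∈ stabilizer e θ σ := by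
  induction σ generalizing l with
  | nil => exact ⟨fun _ => trivial, fun _ => rfl⟩
  | cons y t ih =>
    have h₁ : conjChain alg (y :: t) (some l) = conjChain alg t
      ((alg y.1).rewrite (invRev y.2 ++ ((alg y.1).incl l ++ y.2))) := rfl
    have h₂ : stabilizer e θ (y :: t) =
      conjPullback (θ y.1) (e y.1 (mk y.2)) (stabilizer e θ t) := rfl
    have h₃ : e y.1 (mk (invRev y.2 ++ ((alg y.1).incl l ++ y.2))) =
        (e y.1 (mk y.2))⁻¹ * θ y.1 (k (mk l)) * e y.1 (mk y.2) := by
      rw [← mul_mk, ← mul_mk, ← inv_mk, _root_.map_mul, _root_.map_mul, (alg y.1).eval_incl,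
        _root_.map_inv, mul_assoc]
    rw [h₁, h₂, mem_conjPullback, ← h₃]
    cases hr : (alg y.1).rewrite (invRev y.2 ++ ((alg y.1).incl l ++ y.2)) with
    | none =>
      rw [conjChain_none]
      refine ⟨fun h => by simp at h, ?_⟩
      rintro ⟨d, -, hd⟩
      exact absurd ⟨d, hd.symm⟩ ((alg y.1).notMem_of_rewrite_eq_none hr)
    | some l' =>
      rw [ih, (alg y.1).eval_of_rewrite_eq_some hr]
      constructor
      · exact fun h => ⟨_, h, rfl⟩
      · rintro ⟨d, hd, he⟩
        exact hθ _ he ▸ hd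

theorem generatedByShort_stabilizer (hk : Function.Surjective k)
    (σ : List (Bool × List (Λ × Bool))) :
    GeneratedByShort k (stabilizerBound alg σ) (stabilizer e θ σ) := by
  induction σ with
  | nil => exact generatedByShort_top hk
  | cons y t ih => exact (alg y.1).generatedByShort_conjPullback ih y.2

/-- Such an element lies outside `C`, so singularity means that the stabilizer of its syllables is
nontrivial. That subgroup has generators of computable length, and `conjChain` tests membership in
it. -/
theorem evalState_mem_blackHole_iff_of_ne_nil [Fintype Γ] (hθ : ∀ b, Function.Injective (θ b))
    (hk : Function.Surjective k) {T : List (Bool × List (Λ × Bool)) × List (Γ × Bool)}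
    (hT : IsReducedList θ (T.1.map (toSyllable e))) (hne : T.1 ≠ []) :
    evalState e k θ T ∈ blackHole (base θ).range ↔
      ∃ l ∈ listsUpTo (Γ × Bool) (stabilizerBound alg T.1),
        k (mk l) ≠ 1 ∧ (conjChain alg T.1 (some l)).isSome := by
  have hc : base θ (k (mk T.2)) ∈ (base θ).range := ⟨_, rfl⟩
  have hg : evalState e k θ T ∉ (base θ).range := by
    intro h
    have := hT.eq_nil_of_mem_range hθ (((base θ).range.mul_mem_cancel_right hc).1 h)
    exact hne (by simpa using this)
  simp only [conjChain_isSome_iff hθ]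
  rw [mem_blackHole_of_notMem hg, ← (generatedByShort_stabilizer (alg := alg) hk T.1).ne_bot_iff]
  simp only [ne_eq, Subgroup.eq_bot_iff_forall, not_forall]
  have key : ∀ c, (evalState e k θ T)⁻¹ * base θ c * evalState e k θ T ∈ (base θ).range ↔
      c ∈ stabilizer e θ T.1 := by
    intro c
    rw [mem_stabilizer_iff hθ hT, evalState]
    constructor
    · intro h
      convert mul_mem (mul_mem hc h) (inv_mem hc) using 1
      group
    · intro h
      convert mul_mem (mul_mem (inv_mem hc) h) hc using 1
      group
  have hinj := base_injective hθ
  constructor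
  · rintro ⟨_, ⟨c, rfl⟩, h₁, h₂⟩
    exact ⟨c, (key c).1 h₂, fun h => h₁ (by rw [h, _root_.map_one])⟩
  · rintro ⟨c, h₁, h₂⟩
    exact ⟨_, ⟨c, rfl⟩, fun h => h₂ ((map_eq_one_iff _ hinj).1 h), (key c).2 h₁⟩

/-- The conjugator may be taken in one factor by `base_mem_blackHole_iff`, and then short by
`exists_short_conj`; the conditions on it are checked by `rewrite`. -/
theorem base_mem_blackHole_iff_exists_short [Fintype Λ] (hθ : ∀ b, Function.Injective (θ b))
    (he : ∀ b, Function.Surjective (e b)) (hk : Function.Surjective k)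
    {l : List (Γ × Bool)} (hl : k (mk l) ≠ 1) :
    base θ (k (mk l)) ∈ blackHole (base θ).range ↔
      ∃ b, ∃ w ∈ listsUpTo (Λ × Bool) ((alg b).radius * (l.length + 1)),
        (alg b).rewrite w = none ∧
          ((alg b).rewrite (w ++ ((alg b).incl l ++ invRev w))).isSome := by
  have h₃ : ∀ b w, e b (mk (w ++ ((alg b).incl l ++ invRev w))) =
      e b (mk w) * θ b (k (mk l)) * (e b (mk w))⁻¹ := fun b w => by
    rw [← mul_mk, ← mul_mk, ← inv_mk, _root_.map_mul, _root_.map_mul, (alg b).eval_incl,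
      _root_.map_inv, mul_assoc]
  have h₄ : ∀ b w, ((alg b).rewrite w).isSome ↔ e b (mk w) ∈ (θ b).range := by
    intro b w
    cases hr : (alg b).rewrite w with
    | none => simpa using (alg b).notMem_of_rewrite_eq_none hr
    | some l => simpa using ⟨_, ((alg b).eval_of_rewrite_eq_some hr).symm⟩
  have h₅ : ∀ b w, (alg b).rewrite w = none ↔ e b (mk w) ∉ (θ b).range := by
    intro b w
    rw [← h₄, Option.not_isSome_iff_eq_none]
  simp only [h₄, h₅, h₃]
  rw [base_mem_blackHole_iff hθ (exists_reduced_form alg he hk) hl]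
  refine exists_congr fun b => ⟨?_, ?_⟩
  · rintro ⟨a, ha, hm⟩
    obtain ⟨w, h₁, h₂⟩ := (alg b).exists_short_conj l hl a ha hm
    exact ⟨w, mem_listsUpTo h₁, h₂⟩
  · rintro ⟨w, -, h₁, h₂⟩
    exact ⟨_, h₁, h₂⟩

/-! ### Primitive recursiveness of the procedures. -/

section Primrec

theorem primrec_rewrite : Primrec₂ fun b => (alg b).rewrite :=
  Primrec.bool_dispatch fun b => (alg b).primrec_rewrite

theorem primrec_incl : Primrec₂ fun b => (alg b).incl :=
  Primrec.bool_dispatch fun b => (alg b).primrec_incl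

theorem primrec_mulBase : Primrec₂ (mulBase alg) := by
  refine Primrec.list_casesOn
    (h := fun (p : List (Γ × Bool) × List (Bool × List (Λ × Bool)) × List (Γ × Bool))
      (z : (Bool × List (Λ × Bool)) × List (Bool × List (Λ × Bool))) =>
      ((z.1.1, (alg z.1.1).incl p.1 ++ z.1.2) :: z.2, p.2.2))
    (Primrec.fst.comp Primrec.snd)
    (Primrec.pair (Primrec.const []) (Primrec.list_append.comp Primrec.fst
      (Primrec.snd.comp Primrec.snd))) ?_
  refine Primrec.pair (Primrec.list_cons.comp (Primrec.pair ?_ (Primrec.list_append.comp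
    (primrec_incl.comp ?_ (Primrec.fst.comp Primrec.fst)) ?_)) (Primrec.snd.comp Primrec.snd))
    (Primrec.snd.comp (Primrec.snd.comp Primrec.fst))
  · exact Primrec.fst.comp (Primrec.fst.comp Primrec.snd)
  · exact Primrec.fst.comp (Primrec.fst.comp Primrec.snd)
  · exact Primrec.snd.comp (Primrec.fst.comp Primrec.snd)

theorem primrec_absorb : Primrec fun p : (Bool × List (Λ × Bool)) × List (Bool × List (Λ × Bool)) =>
    absorb p.1.1 p.1.2 p.2 := by
  refine Primrec.list_casesOn
    (h := fun (p : (Bool × List (Λ × Bool)) × List (Bool × List (Λ × Bool)))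
      (z : (Bool × List (Λ × Bool)) × List (Bool × List (Λ × Bool))) =>
      if z.1.1 = p.1.1 then (p.1.2 ++ z.1.2, z.2) else (p.1.2, z.1 :: z.2))
    Primrec.snd
    (Primrec.pair (Primrec.snd.comp Primrec.fst) (Primrec.const [])) ?_
  have v : Primrec fun x : ((Bool × List (Λ × Bool)) × List (Bool × List (Λ × Bool))) ×
      ((Bool × List (Λ × Bool)) × List (Bool × List (Λ × Bool))) => x.1.1.2 :=
    Primrec.snd.comp (Primrec.fst.comp Primrec.fst)
  refine Primrec.ite (Primrec.eq.comp (Primrec.fst.comp (Primrec.fst.comp Primrec.snd))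
    (Primrec.fst.comp (Primrec.fst.comp Primrec.fst)))
    (Primrec.pair (Primrec.list_append.comp v (Primrec.snd.comp (Primrec.fst.comp Primrec.snd)))
      (Primrec.snd.comp Primrec.snd))
    (Primrec.pair v (Primrec.list_cons.comp (Primrec.fst.comp Primrec.snd)
      (Primrec.snd.comp Primrec.snd)))

theorem primrec_push : Primrec fun p : (Bool × List (Λ × Bool)) ×
    List (Bool × List (Λ × Bool)) × List (Γ × Bool) => push alg p.1.1 p.1.2 p.2 := by
  have a : Primrec fun p : (Bool × List (Λ × Bool)) ×
      List (Bool × List (Λ × Bool)) × List (Γ × Bool) => absorb p.1.1 p.1.2 p.2.1 :=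
    primrec_absorb.comp (Primrec.pair Primrec.fst (Primrec.fst.comp Primrec.snd))
  have b : Primrec fun p : (Bool × List (Λ × Bool)) ×
      List (Bool × List (Λ × Bool)) × List (Γ × Bool) => p.1.1 := Primrec.fst.comp Primrec.fst
  have c : Primrec fun p : (Bool × List (Λ × Bool)) ×
      List (Bool × List (Λ × Bool)) × List (Γ × Bool) => p.2.2 := Primrec.snd.comp Primrec.snd
  exact Primrec.option_casesOn
    (g := fun (p : (Bool × List (Λ × Bool)) ×
      List (Bool × List (Λ × Bool)) × List (Γ × Bool)) l =>
      mulBase alg l ((absorb p.1.1 p.1.2 p.2.1).2, p.2.2))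
    (primrec_rewrite.comp b (Primrec.fst.comp a))
    (Primrec.pair (Primrec.list_cons.comp (Primrec.pair b (Primrec.fst.comp a))
      (Primrec.snd.comp a)) c)
    (primrec_mulBase.comp Primrec.snd (Primrec.pair ((Primrec.snd.comp a).comp Primrec.fst)
      (c.comp Primrec.fst)))

theorem primrec_normalForm [Finite Λ] (side : Λ → Bool) : Primrec (normalForm alg side) := by
  refine Primrec.list_foldr (h := fun (_ : List (Λ × Bool)) p => push alg (side p.1.1) [p.1] p.2)
    Primrec.id (Primrec.const ([], [])) ?_
  refine primrec_push.comp (Primrec.pair (Primrec.pair ((Primrec.dom_finite side).comp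
    (Primrec.fst.comp (Primrec.fst.comp Primrec.snd))) (Primrec.list_cons.comp
    (Primrec.fst.comp Primrec.snd) (Primrec.const []))) (Primrec.snd.comp Primrec.snd))

theorem primrec_conjChain : Primrec₂ (conjChain alg) := by
  refine Primrec.list_foldl (h := fun (_ : List (Bool × List (Λ × Bool)) ×
      Option (List (Γ × Bool))) (p : Option (List (Γ × Bool)) × Bool × List (Λ × Bool)) =>
      p.1.bind fun l => (alg p.2.1).rewrite (invRev p.2.2 ++ ((alg p.2.1).incl l ++ p.2.2)))
    Primrec.fst Primrec.snd ?_
  refine Primrec.option_bind (Primrec.fst.comp Primrec.snd) ?_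
  have y : Primrec fun x : ((List (Bool × List (Λ × Bool)) × Option (List (Γ × Bool))) ×
      Option (List (Γ × Bool)) × Bool × List (Λ × Bool)) × List (Γ × Bool) => x.1.2.2 :=
    Primrec.snd.comp (Primrec.snd.comp Primrec.fst)
  exact primrec_rewrite.comp (Primrec.fst.comp y) (Primrec.list_append.comp
    (primrec_invRev.comp (Primrec.snd.comp y)) (Primrec.list_append.comp
      (primrec_incl.comp (Primrec.fst.comp y) Primrec.snd) (Primrec.snd.comp y)))

theorem primrec_stabilizerBound : Primrec (stabilizerBound alg) := by
  refine Primrec.list_foldr (h := fun (_ : List (Bool × List (Λ × Bool)))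
      (p : (Bool × List (Λ × Bool)) × ℕ) => (alg p.1.1).growth p.2 p.1.2.length)
    Primrec.id (Primrec.const 1) ?_
  have : Primrec₂ fun b (p : ℕ × ℕ) => (alg b).growth p.1 p.2 :=
    Primrec.bool_dispatch fun b => (alg b).primrec_growth
  exact this.comp (Primrec.fst.comp (Primrec.fst.comp Primrec.snd)) (Primrec.pair
    (Primrec.snd.comp Primrec.snd) (Primrec.list_length.comp
    (Primrec.snd.comp (Primrec.fst.comp Primrec.snd))))

end Primrec

theorem primrecPred_mem_regularElements [Fintype Λ] [Fintype Γ]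
    (hθ : ∀ b, Function.Injective (θ b)) (he : ∀ b, Function.Surjective (e b))
    (hk : Function.Surjective k) (alg : ∀ b, FactorAlgorithm (e b) k (θ b)) (side : Λ → Bool) :
    PrimrecPred fun w : List (Λ × Bool) =>
      (w.map fun x => of (φ := θ) (side x.1) (e (side x.1) (mk [x]))).prod ∈
        regularElements (base θ).range := by
  classical
  let P₁ : List (Bool × List (Λ × Bool)) × List (Γ × Bool) → Prop := fun T =>
    ∃ l ∈ listsUpTo (Γ × Bool) (stabilizerBound alg T.1),
      k (mk l) ≠ 1 ∧ (conjChain alg T.1 (some l)).isSome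
  let P₂ : Bool → List (Γ × Bool) → Prop := fun b l =>
    ∃ w ∈ listsUpTo (Λ × Bool) ((alg b).radius * (l.length + 1)),
        (alg b).rewrite w = none ∧
          ((alg b).rewrite (w ++ ((alg b).incl l ++ invRev w))).isSome
  -- Whether `1` is singular depends only on the groups, not on the input word, so this truth value
  -- enters the algorithm as a constant.
  let P₃ : Prop := (1 : Monoid.PushoutI θ) ∈ blackHole (base θ).range
  have hone := (alg true).primrecPred_eq_one
  have hP₁ : PrimrecPred P₁ := by
    have : PrimrecRel fun (l : List (Γ × Bool))
        (T : List (Bool × List (Λ × Bool)) × List (Γ × Bool)) =>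
        k (mk l) ≠ 1 ∧ (conjChain alg T.1 (some l)).isSome := by
      refine PrimrecPred.and (hone.not.comp Primrec.fst) ?_
      exact Primrec.eq.comp (Primrec.option_isSome.comp (primrec_conjChain.comp
        (Primrec.fst.comp Primrec.snd) (Primrec.option_some.comp Primrec.fst)))
        (Primrec.const true)
    exact this.exists_mem_list.comp ((Primrec.listsUpTo _).comp
      (primrec_stabilizerBound.comp Primrec.fst)) Primrec.id
  have hP₂ : ∀ b, PrimrecPred (P₂ b) := by
    intro b
    have : PrimrecRel fun (w : List (Λ × Bool)) (l : List (Γ × Bool)) =>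
        (alg b).rewrite w = none ∧
          ((alg b).rewrite (w ++ ((alg b).incl l ++ invRev w))).isSome := by
      refine PrimrecPred.and (Primrec.eq.comp ((alg b).primrec_rewrite.comp Primrec.fst)
        (Primrec.const none)) ?_
      exact Primrec.eq.comp (Primrec.option_isSome.comp ((alg b).primrec_rewrite.comp
        (Primrec.list_append.comp Primrec.fst (Primrec.list_append.comp
          ((alg b).primrec_incl.comp Primrec.snd) (primrec_invRev.comp Primrec.fst)))))
        (Primrec.const true)
    exact this.exists_mem_list.comp ((Primrec.listsUpTo _).comp (Primrec.nat_mul.comp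
      (Primrec.const _) (Primrec.succ.comp Primrec.list_length))) Primrec.id
  have hP₃ : PrimrecPred fun _ : List (Bool × List (Λ × Bool)) × List (Γ × Bool) => P₃ :=
    (Primrec.const (decide P₃)).primrecPred
  have hnil : PrimrecPred fun T : List (Bool × List (Λ × Bool)) × List (Γ × Bool) => T.1 = [] :=
    Primrec.eq.comp Primrec.fst (Primrec.const [])
  have hone' := hone.comp
    (Primrec.snd (α := List (Bool × List (Λ × Bool))) (β := List (Γ × Bool)))
  have hP₂' := fun b => (hP₂ b).comp
    (Primrec.snd (α := List (Bool × List (Λ × Bool))) (β := List (Γ × Bool)))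
  have hP := ((hnil.and ((hone'.and hP₃).or (hone'.not.and ((hP₂' false).or (hP₂' true))))).or
    (hnil.not.and hP₁)).not.comp (primrec_normalForm (alg := alg) side)
  refine hP.of_eq fun w => ?_
  rw [← evalState_normalForm (alg := alg) (k := k) side w, regularElements, Set.mem_compl_iff,
    not_iff_not]
  have hred := isReducedList_normalForm (alg := alg) side w
  generalize normalForm alg side w = T at hred
  by_cases hT : T.1 = []
  · have hev : evalState e k θ T = base θ (k (mk T.2)) := by simp [evalState, hT]
    rw [hev]
    by_cases h1 : k (mk T.2) = 1
    · simp [hT, h1, P₃]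
    · rw [base_mem_blackHole_iff_exists_short (alg := alg) hθ he hk h1, Bool.exists_bool]
      simp only [hT, h1, P₂, true_and, false_and, false_or, not_false_eq_true, not_true_eq_false,
        or_false]
  · rw [evalState_mem_blackHole_iff_of_ne_nil (alg := alg) hθ hk hred hT]
    simp only [hT, P₁]
    tauto

end Algorithm

end Amalgam

end

/-! ### Application to words in the given generators. -/

open FreeGroup in
theorem FreeGroup.lift_mk_eq_prod {Λ G : Type*} [Group G] (f : Λ → G) (w : List (Λ × Bool)) :
    lift f (mk w) = (w.map fun x => lift f (mk [x])).prod := by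
  induction w with
  | nil => simp [← one_eq_mk]
  | cons x w ih =>
    rw [List.map_cons, List.prod_cons, ← ih, ← _root_.map_mul, mul_mk]
    rfl

theorem FreeGroup.lift_mk_singleton {Λ G : Type*} [Group G] (f : Λ → G) (z : Λ) (c : Bool) :
    FreeGroup.lift f (FreeGroup.mk [(z, c)]) = cond c (f z) (f z)⁻¹ := by
  simp [FreeGroup.lift_mk]

namespace AmalgamatedProduct

variable {A B : Type u}

/-- The tuple of generators of `A` and `B` followed by the projection to one of the factors. -/
def factorLetter [Group A] [Group B] {m n : ℕ} (x : Fin m → A) (y : Fin n → B) :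
    ∀ b : Bool, Fin m ⊕ Fin n → AmalgamFactor A B b
  | false => Sum.elim x fun _ => 1
  | true => Sum.elim (fun _ => 1) y

end AmalgamatedProduct

open AmalgamatedProduct FreeGroup in
theorem mainTheorem7 {A B : Type u} {C : Type v} [Group A] [Group B] [Group C]
    [IsFreeGroup A] [IsFreeGroup B] [Group.FG C]
    (φ : C →* A) (ψ : C →* B) (hφ : Function.Injective φ) (hψ : Function.Injective ψ)
    {m n : ℕ} (x : Fin m → A) (y : Fin n → B)
    (hx : Subgroup.closure (Set.range x) = ⊤) (hy : Subgroup.closure (Set.range y) = ⊤) :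
    ComputablePred fun w : List ((Fin m ⊕ Fin n) × Bool) =>
      AmalgamatedProduct.evalWord φ ψ x y w ∈
        regularElements (AmalgamatedProduct.baseSubgroup φ ψ) := by
  obtain ⟨Γ', _, k', hk'⟩ := Group.fg_iff_exists_freeGroup_hom_surjective_finite.1 ‹Group.FG C›
  obtain ⟨r, ⟨f⟩⟩ := Finite.exists_equiv_fin Γ'
  let k : FreeGroup (Fin r) →* C := k'.comp (freeGroupCongr f.symm).toMonoidHom
  have hk : Function.Surjective k := hk'.comp (freeGroupCongr f.symm).surjective
  -- Both factors share one alphabet, each sending the other's letters to `1`. This is harmless for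
  -- evaluating the input, since `Sum.isRight` sends every letter to its own factor.
  let e : ∀ b, FreeGroup (Fin m ⊕ Fin n) →* AmalgamFactor A B b := fun b =>
    lift (factorLetter x y b)
  have he : ∀ b, Function.Surjective (e b) := by
    intro b
    refine lift_surjective_iff_closure_range_eq_top.2 (top_le_iff.1 ?_)
    cases b
    · refine hx.ge.trans (Subgroup.closure_mono ?_)
      rintro _ ⟨i, rfl⟩
      exact ⟨Sum.inl i, rfl⟩
    · refine hy.ge.trans (Subgroup.closure_mono ?_)
      rintro _ ⟨i, rfl⟩
      exact ⟨Sum.inr i, rfl⟩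
  have hθ : ∀ b, Function.Injective (amalgamLegs φ ψ b) := by
    intro b
    cases b
    exacts [hφ, hψ]
  have hfree : ∀ b, IsFreeGroup (AmalgamFactor A B b) := by
    intro b
    cases b
    · exact inferInstanceAs (IsFreeGroup A)
    · exact inferInstanceAs (IsFreeGroup B)
  have alg : ∀ b, FactorAlgorithm (e b) k (amalgamLegs φ ψ b) := fun b =>
    (exists_factorAlgorithm (e b) (he b) k hk _ (hθ b)).some
  refine (Amalgam.primrecPred_mem_regularElements hθ he hk alg Sum.isRight).computablePred.of_eq
    fun w => ?_
  have : evalWord φ ψ x y w = (w.map fun z => Monoid.PushoutI.of (φ := amalgamLegs φ ψ)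
      (Sum.isRight z.1) (e (Sum.isRight z.1) (mk [z]))).prod := by
    rw [evalWord, lift_mk_eq_prod]
    congr 1
    refine List.map_congr_left fun z _ => ?_
    obtain ⟨z, c⟩ := z
    simp only [e, lift_mk_singleton]
    rcases z with i | i <;> cases c
    · exact (_root_.map_inv (inl φ ψ) (x i)).symm
    · rfl
    · exact (_root_.map_inv (inr φ ψ) (y i)).symm
    · rfl
  rw [this]
  rfl
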